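/- **Setting.** Let $d_{\mathcal P},d_{\mathcal L},d$ be dimensions with $d_{\mathcal P}\ge 1$. Let $\mathcal P\subset\mathbb R^{d_{\mathcal P}}$ and $\mathcal L\subset\mathbb R^{d_{\mathcal L}}$ be compact and convex with $B_{d_{\mathcal P}}(1)\subseteq\mathcal P\subseteq B_{d_{\mathcal P}}(d_{\mathcal P})$. Let $u:\mathcal P\times\mathcal L\to\mathbb R^d$ be bi-affine with $\|u\|\le 1$, and let $p^*:\mathcal L\to\mathcal P$ be an arbitrary response function. Let $D\ge\max(1,d_{\mathcal L})$ be an integer; if $d_{\mathcal L}\le d_{\mathcal P}$ one may take $D=d_{\mathcal P}$. Let $0\le\varepsilon<1/(d_{\mathcal L}+1)$. For actions $(\ell_t)_{t\in\mathcal T}$ let $Q^{\varepsilon}_{\rm int}(\mathcal T)=\bigcap\{\mathrm{conv}\{\ell_t\}_{t\in\mathcal T'}:\mathcal T'\subseteq\mathcal T,\ |\mathcal T'|\ge(1-\varepsilon)|\mathcal T|\}$. Let $S(Q)=\mathrm{conv}\{u(p^*(\ell),\ell):\ell\in Q\}$ and $S^\varepsilon_{\rm int}=S(Q^\varepsilon_{\rm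 int}([T]))$. For a finite set $\mathcal M$ let $\mathrm{offmax}^N_{\mathcal M}(f)=\min_{\mathcal M'\subseteq\mathcal M,\,|\mathcal M'|\ge|\mathcal M|-N}\max_{\mathcal M'}f$, and let it be $0$ if $|\mathcal M|\le N$. **Algorithm.** Split the $T$ rounds into $L\le T$ consecutive epochs $\mathcal T_e$ of length $T/L$ (lengths differing by at most one if $L\nmid T$). Let $\mathcal N\subset\mathcal P$ be a finite $1/T$-cover of $\mathcal P$ with $|\mathcal N|\le(3d_{\mathcal P}^2T)^{d_{\mathcal P}}$. * *Inner learner.* In epoch $e$, with direction $\lambda_e\in B_d(1)$, run a fresh copy of MsMwC with learning rate $\eta$ on the experts $\mathcal N$ with losses $$f_t(p)=\max\Big\{\mathrm{offmax}^{\varepsilon DT}_{\{t'\in\mathcal T_e,\,t'\le t\}}\big(t'\mapsto\langle\lambda_e,u(p,\ell_{t'})\rangle\big),\ \langle\lambda_e,u(p,\ell_t)\rangle\Big\}$$ and play $p_t=\sum_{p\in\mathcal N}x_t(p)\,p$, where $x_t$ is the distribution chosen by MsMwC. Here MsMwC works on $\Omega=\{w\in\Delta(\mathcal N):w_p\ge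 1/(|\mathcal N||\mathcal T_e|)\}$. It starts from the uniform $w'_1$ with $m_1=0$ and uses the predictions $m_t=f_{t-1}$. It chooses $x_t\in\arg\min_{w\in\Omega}\langle w,m_t\rangle+D_\psi(w,w'_t)$ and sets $w'_{t+1}\in\arg\min_{w\in\Omega}\langle w,f_t+32\eta(f_t-m_t)^2\rangle+D_\psi(w,w'_t)$, where $D_\psi$ is the Bregman divergence of $\psi(w)=\eta^{-1}\sum_pw_p\log w_p$. * *Target.* $u^*_e=u(p^*(\ell^*_e),\ell^*_e)$ with $\ell^*_e\in\arg\max_{\ell\in Q_e}\min_{p\in\mathcal P}\langle\lambda_e,u(p,\ell)\rangle$, where $Q_e=Q_{\rm int}^{\varepsilon T/|\mathcal T_e|}(\mathcal T_e)$ (that is, $Q_{\rm int}^{\varepsilon L}(\mathcal T_e)$ if $L\mid T$). * *Outer learner.* $\lambda_1\in B_d(1)$ is arbitrary and $\lambda_{e+1}=\Pi_{B_d(1)}(\lambda_e+e^{-1/2}g_e)$ with $g_e=\frac LT\sum_{t\in\mathcal T_e}(u(p_t,\ell_t)-u_e^*)$. This is online gradient descent on the losses $-\langle\cdot,g_e\rangle$.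 **Theorem.** There are a universal constant $C$ and a choice of the tuning parameters $L\in\{1,\dots,T\}$ and $\eta>0$, depending only on $(T,d_{\mathcal P},D,\varepsilon)$, such that in every instance as above, and for every $T\ge1$, a cover $\mathcal N$ as above exists, and for every such cover and every $\lambda_1$ the following holds. The algorithm plays actions in $\mathcal P$, each depending only on the previous adversary actions. For every sequence $\ell_1,\dots,\ell_T\in\mathcal L$ the set $S^\varepsilon_{\rm int}$ is nonempty and $$\mathrm{dist}\Big(\tfrac1T\sum_{t=1}^Tu(p_t,\ell_t),\,S^\varepsilon_{\rm int}\Big)\le C\,d_{\mathcal P}^{1/3}T^{-1/3}(1+\log T)+C(\varepsilon D)^{1/3}.$$ That is, the algorithm is $\varepsilon$-statistically opportunistic with rate $\gamma(T)=\tilde O(d_{\mathcal P}^{1/3}T^{-1/3})$ and error $\alpha(\varepsilon)=O((\varepsilon D)^{1/3})$. -/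

import Mathlib

open scoped BigOperators

noncomputable section

namespace Opportunistic

/-! ### Generic notions -/

/-- Some minimizer of `f` over `S` (an unspecified point if there is none). -/
def argminOn {α : Type*} [Nonempty α] (S : Set α) (f : α → ℝ) : α :=
  Classical.epsilon fun x => x ∈ S ∧ ∀ y ∈ S, f x ≤ f y

/-- Some maximizer of `f` over `S` (an unspecified point if there is none). -/
def argmaxOn {α : Type*} [Nonempty α] (S : Set α) (f : α → ℝ) : α :=
  Classical.epsilon fun x => x ∈ S ∧ ∀ y ∈ S, f y ≤ f x

/-- The `N`-offset maximum of `h` over the finite set `s`: the minimum, over all subsets `s'` of `s`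
with at least `|s| - N` elements, of the maximum of `h` over `s'`; it is `0` if `|s| ≤ N`. -/
def offMax {ι : Type*} (N : ℝ) (s : Finset ι) (h : ι → ℝ) : ℝ :=
  open Classical in
  if (s.card : ℝ) ≤ N then 0
  else sInf {r : ℝ | ∃ s' ⊆ s, (s.card : ℝ) - N ≤ s'.card ∧ IsGreatest (h '' (s' : Set ι)) r}

/-! ### Adversary sets and targets -/

/-- The adversary Q-sets of the actions `(ℓ t)`, `t ∈ s`: the convex hulls of the subfamilies that
retain at least a `1 - ε` fraction of the rounds in `s`. -/
def qSets {V : Type*} [AddCommGroup V] [Module ℝ V] (ε : ℝ) (s : Finset ℕ) (ℓ : ℕ → V) :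
    Set (Set V) :=
  {Q | ∃ s' ⊆ s, (1 - ε) * (s.card : ℝ) ≤ s'.card ∧ Q = convexHull ℝ (ℓ '' (s' : Set ℕ))}

/-- The intersection of all adversary Q-sets. -/
def qInt {V : Type*} [AddCommGroup V] [Module ℝ V] (ε : ℝ) (s : Finset ℕ) (ℓ : ℕ → V) : Set V :=
  ⋂₀ qSets ε s ℓ

/-- `S(Q)`, the convex hull of the payoffs `u(p*(x), x)`, `x ∈ Q`. -/
def targetSet {X Y V : Type*} [AddCommGroup V] [Module ℝ V] (u : X → Y → V) (pstar : Y → X)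
    (Q : Set Y) : Set V :=
  convexHull ℝ ((fun x => u (pstar x) x) '' Q)

/-! ### The expert algorithm MsMwC with optimism -/

section MsMwC

variable {ι : Type*} [Fintype ι]

/-- The probability vectors on `ι` all of whose entries are at least `1 / (|ι| n)`. -/
def truncSimplex (ι : Type*) [Fintype ι] (n : ℕ) : Set (ι → ℝ) :=
  {w | ∑ i, w i = 1 ∧ ∀ i, 1 / ((Fintype.card ι : ℝ) * n) ≤ w i}

/-- Bregman divergence of the weighted negative entropy `w ↦ ∑ i, w i * log (w i) / η i`. -/
def bregman (η w w' : ι → ℝ) : ℝ :=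
  ∑ i, (1 / η i) * (w i * Real.log (w i / w' i) - w i + w' i)

/-- The optimistic prediction: the loss vector of the previous round (zero in the first round). -/
def prediction (y : ℕ → ι → ℝ) : ℕ → ι → ℝ
  | 0 => fun _ => 0
  | t + 1 => y t

/-- The auxiliary iterates of Multi-scale Multiplicative-weight with Correction (MsMwC), run for `n`
rounds on the loss vectors `y` with learning rate `η t i` for expert `i` in round `t`. Rounds are
numbered from `0`. Each update uses the loss plus the correction `32 η (y - m)²`. -/
def msmwcAux (η : ℕ → ι → ℝ) (n : ℕ) (y : ℕ → ι → ℝ) : ℕ → ι → ℝ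
  | 0 => fun _ => 1 / (Fintype.card ι : ℝ)
  | t + 1 => argminOn (truncSimplex ι n) fun w =>
      ∑ i, w i * (y t i + 32 * η t i * (y t i - prediction y t i) ^ 2)
        + bregman (η t) w (msmwcAux η n y t)

/-- The distribution over experts that MsMwC chooses in round `t`. -/
def msmwc (η : ℕ → ι → ℝ) (n : ℕ) (y : ℕ → ι → ℝ) (t : ℕ) : ι → ℝ :=
  argminOn (truncSimplex ι n) fun w =>
    ∑ i, w i * prediction y t i + bregman (η t) w (msmwcAux η n y t)

end MsMwC

/-! ### Epochs

The rounds are `0, …, T - 1` and the epochs `0, …, L - 1`. If `L` divides `T` then every epoch has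
`T / L` rounds; otherwise the lengths of the epochs differ by at most one. -/

/-- First round of epoch `e`. -/
def epochStart (T L e : ℕ) : ℕ := e * T / L

/-- The rounds of epoch `e`. -/
def epoch (T L e : ℕ) : Finset ℕ := Finset.Ico (epochStart T L e) (epochStart T L (e + 1))

/-- The epoch of round `t`: the last epoch that starts no later than `t`. -/
def epochOf (T L t : ℕ) : ℕ := Nat.findGreatest (fun e => epochStart T L e ≤ t) L

/-- Euclidean projection onto the closed unit ball. -/
def ballProj {V : Type*} [NormedAddCommGroup V] [NormedSpace ℝ V] (x : V) : V :=
  (max 1 ‖x‖)⁻¹ • x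

/-- `N` is a finite subset of `P`, every point of `P` is within `1 / T` of a point of `N`, and
`|N| ≤ (3 n² T) ^ n`, where `n` is the dimension. -/
def IsActionCover {n : ℕ} (T : ℕ) (P : Set (EuclideanSpace ℝ (Fin n)))
    (N : Finset (EuclideanSpace ℝ (Fin n))) : Prop :=
  (N : Set (EuclideanSpace ℝ (Fin n))) ⊆ P ∧
  (∀ p ∈ P, ∃ q ∈ N, dist p q ≤ 1 / (T : ℝ)) ∧
  (N.card : ℝ) ≤ (3 * (n : ℝ) ^ 2 * T) ^ n

/-! ### The epoch-based opportunistic learner -/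

section Learner

variable {dP dL d : ℕ}

/-- The offset-max loss `f_t` of round `t` in an epoch that starts in round `a`, in direction `lam`:
the larger of the `K`-offset maximum of `⟨lam, u(p, ℓ_s)⟩` over the rounds `a ≤ s ≤ t` and the current
value `⟨lam, u(p, ℓ_t)⟩`. -/
def offsetLoss (u : EuclideanSpace ℝ (Fin dP) → EuclideanSpace ℝ (Fin dL) → EuclideanSpace ℝ (Fin d))
    (K : ℝ) (ℓ : ℕ → EuclideanSpace ℝ (Fin dL)) (lam : EuclideanSpace ℝ (Fin d)) (a t : ℕ)
    (p : EuclideanSpace ℝ (Fin dP)) : ℝ :=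
  max (offMax K (Finset.Icc a t) fun s => inner ℝ lam (u p (ℓ s))) (inner ℝ lam (u p (ℓ t)))

/-- The action played in round `t` of epoch `e`, if the direction of that epoch is `lam`: a fresh copy
of MsMwC is run from the start of the epoch on the experts `N` with the offset-max losses, and the
barycenter of its distribution is played. The rounds of the epoch up to `t` enter only through the
losses of rounds before `t`. -/
def innerPlay (u : EuclideanSpace ℝ (Fin dP) → EuclideanSpace ℝ (Fin dL) → EuclideanSpace ℝ (Fin d))
    (T L : ℕ) (K : ℝ) (N : Finset (EuclideanSpace ℝ (Fin dP))) (η : ℕ → N → ℝ)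
    (ℓ : ℕ → EuclideanSpace ℝ (Fin dL)) (lam : EuclideanSpace ℝ (Fin d)) (e t : ℕ) :
    EuclideanSpace ℝ (Fin dP) :=
  ∑ p : N,
    msmwc η (epoch T L e).card
      (fun s q => offsetLoss u K ℓ lam (epochStart T L e) (epochStart T L e + s) q)
      (t - epochStart T L e) p • (p : EuclideanSpace ℝ (Fin dP))

/-- The intersection set of an epoch: `ε T` rounds may be discarded, which is a fraction `ε L` of the
rounds of the epoch if `L` divides `T`. -/
def epochInt (T L : ℕ) (ε : ℝ) (ℓ : ℕ → EuclideanSpace ℝ (Fin dL)) (e : ℕ) :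
    Set (EuclideanSpace ℝ (Fin dL)) :=
  qInt (ε * T / ((epoch T L e).card : ℝ)) (epoch T L e) ℓ

/-- The maximin target of an epoch: `u(p*(x), x)`, where `x` maximizes `min_{p ∈ P} ⟨lam, u(p, x)⟩`
over the intersection set of the epoch. -/
def epochTarget (P : Set (EuclideanSpace ℝ (Fin dP)))
    (u : EuclideanSpace ℝ (Fin dP) → EuclideanSpace ℝ (Fin dL) → EuclideanSpace ℝ (Fin d))
    (pstar : EuclideanSpace ℝ (Fin dL) → EuclideanSpace ℝ (Fin dP))
    (T L : ℕ) (ε : ℝ) (ℓ : ℕ → EuclideanSpace ℝ (Fin dL)) (lam : EuclideanSpace ℝ (Fin d)) (e : ℕ) :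
    EuclideanSpace ℝ (Fin d) :=
  let x := argmaxOn (epochInt T L ε ℓ e) fun x => ⨅ p : P, inner ℝ lam (u p x)
  u (pstar x) x

/-- The directions chosen by the outer learner: online projected gradient ascent on the unit ball with
step sizes `1 / √(e + 1)` for the linear gains `⟨·, g_e⟩`, where `g_e` is `L / T` times the sum of
`u(p_t, ℓ_t) - u*_e` over the rounds of epoch `e`. -/
def direction (P : Set (EuclideanSpace ℝ (Fin dP)))
    (u : EuclideanSpace ℝ (Fin dP) → EuclideanSpace ℝ (Fin dL) → EuclideanSpace ℝ (Fin d))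
    (pstar : EuclideanSpace ℝ (Fin dL) → EuclideanSpace ℝ (Fin dP))
    (T L : ℕ) (ε K : ℝ) (N : Finset (EuclideanSpace ℝ (Fin dP))) (η : ℕ → N → ℝ)
    (lam₀ : EuclideanSpace ℝ (Fin d)) (ℓ : ℕ → EuclideanSpace ℝ (Fin dL)) :
    ℕ → EuclideanSpace ℝ (Fin d)
  | 0 => lam₀
  | e + 1 =>
    let lam := direction P u pstar T L ε K N η lam₀ ℓ e
    let g : EuclideanSpace ℝ (Fin d) := ((L : ℝ) / T) • ∑ t ∈ epoch T L e,
      (u (innerPlay u T L K N η ℓ lam e t) (ℓ t) - epochTarget P u pstar T L ε ℓ lam e)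
    ballProj (lam + (1 / Real.sqrt ((e : ℝ) + 1)) • g)

/-- The action that the epoch-based opportunistic learner plays in round `t` against the adversary
sequence `ℓ`, with horizon `T`, `L` epochs, offset `K`, experts `N`, learning rates `η` of the inner
learner and initial direction `lam₀`. -/
def epochLearner (P : Set (EuclideanSpace ℝ (Fin dP)))
    (u : EuclideanSpace ℝ (Fin dP) → EuclideanSpace ℝ (Fin dL) → EuclideanSpace ℝ (Fin d))
    (pstar : EuclideanSpace ℝ (Fin dL) → EuclideanSpace ℝ (Fin dP))
    (T L : ℕ) (ε K : ℝ) (N : Finset (EuclideanSpace ℝ (Fin dP))) (η : ℕ → N → ℝ)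
    (lam₀ : EuclideanSpace ℝ (Fin d)) (ℓ : ℕ → EuclideanSpace ℝ (Fin dL)) (t : ℕ) :
    EuclideanSpace ℝ (Fin dP) :=
  innerPlay u T L K N η ℓ
    (direction P u pstar T L ε K N η lam₀ ℓ (epochOf T L t)) (epochOf T L t) t

/-- Over the horizon `T`, the algorithm `A` is `ε`-statistically opportunistic with rate `γ` and error
`α`: it is a legitimate learner (its actions lie in `P`, and its action in round `t` depends only on
the adversary's actions before round `t`), and against every adversary sequence in `𝓛` the target set
`S(Q_int)` is nonempty and the average payoff is within `γ + α` of it. -/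
structure IsStatisticallyOpportunistic (P : Set (EuclideanSpace ℝ (Fin dP)))
    (𝓛 : Set (EuclideanSpace ℝ (Fin dL)))
    (u : EuclideanSpace ℝ (Fin dP) → EuclideanSpace ℝ (Fin dL) → EuclideanSpace ℝ (Fin d))
    (pstar : EuclideanSpace ℝ (Fin dL) → EuclideanSpace ℝ (Fin dP)) (ε : ℝ) (T : ℕ)
    (A : (ℕ → EuclideanSpace ℝ (Fin dL)) → ℕ → EuclideanSpace ℝ (Fin dP)) (γ α : ℝ) : Prop where
  action_mem : ∀ ℓ : ℕ → EuclideanSpace ℝ (Fin dL), (∀ t < T, ℓ t ∈ 𝓛) → ∀ t < T, A ℓ t ∈ P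
  nonanticipating : ∀ ℓ ℓ' : ℕ → EuclideanSpace ℝ (Fin dL), ∀ t < T,
    (∀ s < t, ℓ s = ℓ' s) → A ℓ t = A ℓ' t
  target_nonempty : ∀ ℓ : ℕ → EuclideanSpace ℝ (Fin dL), (∀ t < T, ℓ t ∈ 𝓛) →
    (targetSet u pstar (qInt ε (Finset.range T) ℓ)).Nonempty
  dist_le : ∀ ℓ : ℕ → EuclideanSpace ℝ (Fin dL), (∀ t < T, ℓ t ∈ 𝓛) →
    Metric.infDist ((1 / (T : ℝ)) • ∑ t ∈ Finset.range T, u (A ℓ t) (ℓ t))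
      (targetSet u pstar (qInt ε (Finset.range T) ℓ)) ≤ γ + α

end Learner

end Opportunistic

end

namespace Opportunistic

/-! ### Offset maxima -/

/-! Approachability by duality. Gradient ascent on the directions `λ_e` has regret `O(√L)` against
the best fixed direction, so `‖∑ g_e‖ ≤ ∑ ⟨λ_e, g_e⟩ + 18√L` (`norm_sum_le_of_gradient_ascent`). The
length-weighted average of the epoch targets lies in the convex set `S_int`, because an epoch
discards as many rounds as the whole horizon may discard (`qInt_mono`). Hence the distance is at
most `‖∑ g_e‖ / L`, and it remains to bound each `⟨λ_e, g_e⟩`.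

Within an epoch, minimax gives `p₀ ∈ P` whose scalar payoff on the intersection set never exceeds
that of the target (`argmax_maximin_spec`). By Helly's theorem, a half-space containing more than
`dL·εT` actions of the epoch meets the intersection set (`inter_qInt_nonempty`). So `p₀` exceeds the
target value in at most `K = εDT` rounds, and an expert near `p₀` has offset-max losses at most the
target value plus `1/T`, up to a total of `O(K)` (`sum_runLoss_le`).

Offset-max losses dominate the true payoffs yet vary slowly: their path length is `O(K + 1)`
whatever the epoch length (`sum_abs_runLoss_sub_le`). The optimistic expert algorithm pays only for
this variation (`msmwc_regret`), so with a constant learning rate an epoch costs `O(log |N| + K +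
1)` (`epoch_regret`). Choosing `L` of order `((dP/T)^(1/3) + (εD)^(1/3))^(-2)` balances `(L/T)(dP
log T + K)` against `1/√L`. -/

theorem offMax_of_le {ι : Type*} {N : ℝ} {s : Finset ι} {h : ι → ℝ} (hs : (s.card : ℝ) ≤ N) :
    offMax N s h = 0 := by
  rw [offMax, if_pos hs]

/-- Every candidate is a value of `h` on `s`. Finiteness makes the `sInf` in `offMax` an attained
minimum. -/
theorem offMax_candidates_finite {ι : Type*} (N : ℝ) (s : Finset ι) (h : ι → ℝ) :
    {r : ℝ | ∃ s' ⊆ s, (s.card : ℝ) - N ≤ s'.card ∧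
      IsGreatest (h '' (s' : Set ι)) r}.Finite := by
  refine (s.finite_toSet.image h).subset ?_
  rintro r ⟨s', hs', -, hr, -⟩
  exact Set.image_mono (by exact_mod_cast hs') hr

theorem exists_isGreatest_image {ι : Type*} {s : Finset ι} (hs : s.Nonempty) (h : ι → ℝ) :
    ∃ r, IsGreatest (h '' (s : Set ι)) r := by
  obtain ⟨i, hi, hmax⟩ := s.exists_max_image h hs
  exact ⟨h i, ⟨i, hi, rfl⟩, by rintro _ ⟨j, hj, rfl⟩; exact hmax j hj⟩

theorem offMax_mem_candidates {ι : Type*} {N : ℝ} {s : Finset ι} {h : ι → ℝ} (hN : 0 ≤ N)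
    (hs : N < s.card) :
    ∃ s' ⊆ s, (s.card : ℝ) - N ≤ s'.card ∧ IsGreatest (h '' (s' : Set ι)) (offMax N s h) := by
  have hne : s.Nonempty := Finset.card_pos.1 (by exact_mod_cast hN.trans_lt hs)
  obtain ⟨r, hr⟩ := exists_isGreatest_image hne h
  rw [offMax, if_neg (not_le.2 hs)]
  exact Set.Nonempty.csInf_mem (s := {r : ℝ | ∃ s' ⊆ s, (s.card : ℝ) - N ≤ s'.card ∧
    IsGreatest (h '' (s' : Set ι)) r})
    ⟨r, s, Finset.Subset.refl s, by linarith, hr⟩ (offMax_candidates_finite N s h)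

theorem offMax_mem_image {ι : Type*} {N : ℝ} {s : Finset ι} {h : ι → ℝ} (hN : 0 ≤ N)
    (hs : N < s.card) : ∃ i ∈ s, offMax N s h = h i := by
  obtain ⟨s', hs', -, ⟨i, hi, hr⟩, -⟩ := offMax_mem_candidates (h := h) hN hs
  exact ⟨i, hs' hi, hr.symm⟩

/-- With `offMax_le_of_card_le` this identifies `offMax` as an upper quantile: the least level that
at most `N` of the values exceed. -/
theorem card_offMax_lt_le {ι : Type*} {N : ℝ} {s : Finset ι} {h : ι → ℝ} (hN : 0 ≤ N)
    (hs : N < s.card) : ((s.filter fun i => offMax N s h < h i).card : ℝ) ≤ N := by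
  classical
  obtain ⟨s', hs', hc, -, hub⟩ := offMax_mem_candidates (h := h) hN hs
  have hsub : s.filter (fun i => offMax N s h < h i) ⊆ s \ s' := by
    intro i hi
    rw [Finset.mem_filter] at hi
    refine Finset.mem_sdiff.2 ⟨hi.1, fun his => ?_⟩
    exact absurd (hub ⟨i, his, rfl⟩) (not_le.2 hi.2)
  have h1 := Finset.card_le_card hsub
  have h2 := Finset.card_sdiff_add_card_eq_card hs'
  have h3 : ((s \ s').card : ℝ) + s'.card = s.card := by exact_mod_cast h2
  have h4 : ((s.filter fun i => offMax N s h < h i).card : ℝ) ≤ (s \ s').card := by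
    exact_mod_cast h1
  linarith

theorem offMax_le_of_card_le {ι : Type*} {N : ℝ} {s : Finset ι} {h : ι → ℝ} {c : ℝ}
    (hs : N < s.card) (hc : ((s.filter fun i => c < h i).card : ℝ) ≤ N) : offMax N s h ≤ c := by
  have hcard : ((s.filter fun i => c < h i).card : ℝ) +
      ((s.filter fun i => ¬ c < h i).card : ℝ) = s.card := by
    exact_mod_cast Finset.card_filter_add_card_filter_not (s := s) (fun i => c < h i)
  have hne : (s.filter fun i => ¬ c < h i).Nonempty := by
    rw [← Finset.card_pos]
    have : (0 : ℝ) < ((s.filter fun i => ¬ c < h i).card : ℝ) := by linarith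
    exact_mod_cast this
  obtain ⟨r, hr⟩ := exists_isGreatest_image hne h
  have hrc : r ≤ c := by
    obtain ⟨i, hi, rfl⟩ := hr.1
    have := (Finset.mem_filter.1 (Finset.mem_coe.1 hi)).2
    exact not_lt.1 this
  rw [offMax, if_neg (not_le.2 hs)]
  refine (csInf_le (offMax_candidates_finite N s h).bddBelow ?_).trans hrc
  exact ⟨_, Finset.filter_subset _ _, by linarith, hr⟩

theorem abs_offMax_le {ι : Type*} {N : ℝ} {s : Finset ι} {h : ι → ℝ} (hN : 0 ≤ N) {B : ℝ}
    (hB : 0 ≤ B) (hh : ∀ i ∈ s, |h i| ≤ B) : |offMax N s h| ≤ B := by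
  rcases le_or_gt (s.card : ℝ) N with hs | hs
  · rwa [offMax_of_le hs, abs_zero]
  · obtain ⟨i, hi, e⟩ := offMax_mem_image (h := h) hN hs
    rw [e]
    exact hh i hi

/-- A level good for `s'` is good for `s`. The bound `N < s.card` matters: leaving the default value
`0` can be a drop. -/
theorem offMax_mono {ι : Type*} {N : ℝ} {s s' : Finset ι} {h : ι → ℝ} (hN : 0 ≤ N)
    (hs : N < s.card) (hss : s ⊆ s') : offMax N s h ≤ offMax N s' h := by
  have hs' : N < s'.card := hs.trans_le (by exact_mod_cast Finset.card_le_card hss)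
  refine offMax_le_of_card_le hs (le_trans ?_ (card_offMax_lt_le (h := h) hN hs'))
  exact_mod_cast Finset.card_le_card (Finset.filter_subset_filter _ hss)

theorem offMax_congr {ι : Type*} {N : ℝ} {s : Finset ι} {h h' : ι → ℝ} (hh : ∀ i ∈ s, h i = h' i) :
    offMax N s h = offMax N s h' := by
  have : ∀ s' ⊆ s, h '' (s' : Set ι) = h' '' (s' : Set ι) := fun s' hs' =>
    Set.image_congr fun i hi => hh i (hs' hi)
  unfold offMax
  split_ifs
  · rfl
  · congr 1
    ext r
    constructor
    · rintro ⟨s', h1, h2, h3⟩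
      exact ⟨s', h1, h2, this s' h1 ▸ h3⟩
    · rintro ⟨s', h1, h2, h3⟩
      exact ⟨s', h1, h2, (this s' h1).symm ▸ h3⟩

/-! ### Running offset losses of a sequence -/

/-- The offset-max loss of the sequence `h` after the rounds `a, …, a + t`. -/
noncomputable def runLoss (K : ℝ) (a : ℕ) (h : ℕ → ℝ) (t : ℕ) : ℝ :=
  max (offMax K (Finset.Icc a (a + t)) h) (h (a + t))

/-- The loss of the previous round, zero in the first round. -/
noncomputable def runPrev (K : ℝ) (a : ℕ) (h : ℕ → ℝ) : ℕ → ℝ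
  | 0 => 0
  | t + 1 => runLoss K a h t

/-- The offset maximum leaves its default branch exactly at local round `⌊K⌋₊`; this separates a
warm-up of at most `K` rounds from the monotone phase. -/
theorem lt_card_Icc_iff {K : ℝ} (hK : 0 ≤ K) (a t : ℕ) :
    K < ((Finset.Icc a (a + t)).card : ℝ) ↔ ⌊K⌋₊ ≤ t := by
  rw [Nat.card_Icc, show a + t + 1 - a = t + 1 by omega, ← Nat.floor_lt hK, Nat.lt_succ_iff]

theorem abs_runLoss_le {K : ℝ} (hK : 0 ≤ K) {a t : ℕ} {h : ℕ → ℝ}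
    (hh : ∀ s, a ≤ s → s ≤ a + t → |h s| ≤ 1) : |runLoss K a h t| ≤ 1 := by
  have h1 : |offMax K (Finset.Icc a (a + t)) h| ≤ 1 :=
    abs_offMax_le hK zero_le_one fun i hi => hh i (Finset.mem_Icc.1 hi).1 (Finset.mem_Icc.1 hi).2
  have h2 := hh (a + t) (by omega) le_rfl
  rw [abs_le] at *
  exact ⟨h1.1.trans (le_max_left _ _), max_le h1.2 h2.2⟩

theorem abs_runPrev_le {K : ℝ} (hK : 0 ≤ K) {a t : ℕ} {h : ℕ → ℝ}
    (hh : ∀ s, a ≤ s → s < a + t → |h s| ≤ 1) : |runPrev K a h t| ≤ 1 := by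
  cases t with
  | zero => simp [runPrev]
  | succ t => exact abs_runLoss_le hK fun s h1 h2 => hh s h1 (by omega)

theorem abs_runLoss_sub_runPrev_le {K : ℝ} (hK : 0 ≤ K) {a t : ℕ} {h : ℕ → ℝ}
    (hh : ∀ s, a ≤ s → s ≤ a + t → |h s| ≤ 1) : |runLoss K a h t - runPrev K a h t| ≤ 2 := by
  have h1 := abs_runLoss_le hK hh
  have h2 := abs_runPrev_le hK (t := t) (a := a) fun s h1 h2 => hh s h1 h2.le
  rw [abs_le] at *
  constructor <;> linarith

/-- The excess of the values `h s`, `s ∈ S`, over the level `c`. -/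
noncomputable def excess (S : Finset ℕ) (h : ℕ → ℝ) (c : ℝ) : ℝ := ∑ s ∈ S, max (h s - c) 0

theorem excess_le {S : Finset ℕ} {h : ℕ → ℝ} {c B K : ℝ} (hB : 0 ≤ B)
    (hh : ∀ s ∈ S, h s - c ≤ B) (hK : ((S.filter fun s => c < h s).card : ℝ) ≤ K) :
    excess S h c ≤ K * B := by
  have : excess S h c ≤ ∑ s ∈ S, if c < h s then B else 0 := by
    refine Finset.sum_le_sum fun s hs => ?_
    split_ifs with hc
    · exact max_le (hh s hs) hB
    · exact max_le (by linarith) le_rfl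
  refine this.trans ?_
  rw [← Finset.sum_filter, Finset.sum_const, nsmul_eq_mul]
  exact mul_le_mul_of_nonneg_right hK hB

/-- Only the at most `K` values above the old level feel the raise, and each loses at most `c' - c`.
-/
theorem excess_sub_le {S : Finset ℕ} {h : ℕ → ℝ} {c c' K : ℝ} (hc : c ≤ c')
    (hK : ((S.filter fun s => c < h s).card : ℝ) ≤ K) :
    excess S h c - K * (c' - c) ≤ excess S h c' := by
  have : excess S h c - excess S h c' ≤ ∑ s ∈ S, if c < h s then c' - c else 0 := by
    rw [excess, excess, ← Finset.sum_sub_distrib]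
    refine Finset.sum_le_sum fun s _ => ?_
    have := le_max_left (h s - c') 0
    have := le_max_right (h s - c') 0
    split_ifs with h1
    · rw [max_eq_left (by linarith : (0 : ℝ) ≤ h s - c)]
      linarith
    · rw [max_eq_right (by linarith : h s - c ≤ 0)]
      linarith
  rw [← Finset.sum_filter, Finset.sum_const, nsmul_eq_mul] at this
  have := mul_le_mul_of_nonneg_right hK (sub_nonneg.2 hc)
  linarith

/-- A potential argument. Write the loss as `O + d`, with `O` the nondecreasing offset maximum and
`d` the spike of the current value above it. A step costs at most the old spike, the new spike and
the rise of `O`. A new spike enters the excess over `O`, and a rise of `O` removes at most `K` times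
that rise. Twice the excess therefore pays for every spike going up and coming down; the term
`-(runLoss - offMax)` records that the last spike has not yet come down. -/
theorem sum_abs_runLoss_sub_le_of_floor_le {K : ℝ} (hK : 0 ≤ K) {a : ℕ} {h : ℕ → ℝ} (n : ℕ)
    (hn : ⌊K⌋₊ ≤ n) (hh : ∀ s, a ≤ s → s ≤ a + n → |h s| ≤ 1) :
    ∑ t ∈ Finset.range (n + 1), |runLoss K a h t - runPrev K a h t| ≤
      2 * (⌊K⌋₊ + 1) +
      2 * excess (Finset.Icc a (a + n)) h (offMax K (Finset.Icc a (a + n)) h) -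
      (runLoss K a h n - offMax K (Finset.Icc a (a + n)) h) +
      (2 * K + 1) * (offMax K (Finset.Icc a (a + n)) h -
        offMax K (Finset.Icc a (a + ⌊K⌋₊)) h) := by
  have hloss : ∀ t, runLoss K a h t - offMax K (Finset.Icc a (a + t)) h =
      max (h (a + t) - offMax K (Finset.Icc a (a + t)) h) 0 := by
    intro t
    rw [runLoss, ← max_sub_sub_right, sub_self, max_comm]
  induction n, hn using Nat.le_induction with
  | base =>
    have h1 : ∑ t ∈ Finset.range (⌊K⌋₊ + 1), |runLoss K a h t - runPrev K a h t| ≤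
        ∑ t ∈ Finset.range (⌊K⌋₊ + 1), 2 := by
      refine Finset.sum_le_sum fun t ht => abs_runLoss_sub_runPrev_le hK fun s h1 h2 => hh s h1 ?_
      have := Finset.mem_range.1 ht
      omega
    rw [Finset.sum_const, Finset.card_range, nsmul_eq_mul] at h1
    push_cast at h1
    have h2 : max (h (a + ⌊K⌋₊) - offMax K (Finset.Icc a (a + ⌊K⌋₊)) h) 0 ≤
        excess (Finset.Icc a (a + ⌊K⌋₊)) h (offMax K (Finset.Icc a (a + ⌊K⌋₊)) h) :=
      Finset.single_le_sum (f := fun s => max (h s - offMax K (Finset.Icc a (a + ⌊K⌋₊)) h) 0)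
        (fun s _ => le_max_right _ _) (Finset.mem_Icc.2 ⟨by omega, le_rfl⟩)
    have h3 := le_max_right (h (a + ⌊K⌋₊) - offMax K (Finset.Icc a (a + ⌊K⌋₊)) h) 0
    rw [hloss, sub_self, mul_zero]
    linarith
  | succ n hn ih =>
    have ih := ih fun s h1 h2 => hh s h1 (by omega)
    rw [Finset.sum_range_succ]
    have hIcc : Finset.Icc a (a + (n + 1)) = insert (a + (n + 1)) (Finset.Icc a (a + n)) := by
      ext s
      simp only [Finset.mem_Icc, Finset.mem_insert]
      omega
    have hcard := (lt_card_Icc_iff hK a n).2 hn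
    have hmono : offMax K (Finset.Icc a (a + n)) h ≤ offMax K (Finset.Icc a (a + (n + 1))) h :=
      offMax_mono hK hcard (Finset.Icc_subset_Icc_right (by omega))
    have hex := excess_sub_le (S := Finset.Icc a (a + n)) (h := h) hmono
      (card_offMax_lt_le hK hcard)
    have hex' : excess (Finset.Icc a (a + (n + 1))) h (offMax K (Finset.Icc a (a + (n + 1))) h) =
        max (h (a + (n + 1)) - offMax K (Finset.Icc a (a + (n + 1))) h) 0 +
        excess (Finset.Icc a (a + n)) h (offMax K (Finset.Icc a (a + (n + 1))) h) := by
      conv_lhs => rw [excess, hIcc, Finset.sum_insert (by simp)]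
      rw [← hIcc, excess]
    rw [← hloss] at hex'
    have e1 : 0 ≤ runLoss K a h (n + 1) - offMax K (Finset.Icc a (a + (n + 1))) h := by
      rw [hloss]; exact le_max_right _ _
    have e0 : 0 ≤ runLoss K a h n - offMax K (Finset.Icc a (a + n)) h := by
      rw [hloss]; exact le_max_right _ _
    have habs : |runLoss K a h (n + 1) - runPrev K a h (n + 1)| ≤
        (runLoss K a h (n + 1) - offMax K (Finset.Icc a (a + (n + 1))) h) +
        (runLoss K a h n - offMax K (Finset.Icc a (a + n)) h) +
        (offMax K (Finset.Icc a (a + (n + 1))) h - offMax K (Finset.Icc a (a + n)) h) := by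
      rw [runPrev, abs_le]
      constructor <;> linarith
    rw [hex']
    linarith

/-- The offset-max losses of a sequence in `[-1, 1]` have bounded path length. -/
theorem sum_abs_runLoss_sub_le {K : ℝ} (hK : 0 ≤ K) {a n : ℕ} {h : ℕ → ℝ}
    (hh : ∀ s, a ≤ s → s < a + n → |h s| ≤ 1) :
    ∑ t ∈ Finset.range n, |runLoss K a h t - runPrev K a h t| ≤ 14 * K + 4 := by
  rcases le_or_gt n ⌊K⌋₊ with hn | hn
  · have h1 : ∑ t ∈ Finset.range n, |runLoss K a h t - runPrev K a h t| ≤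
        ∑ t ∈ Finset.range n, 2 := by
      refine Finset.sum_le_sum fun t ht => abs_runLoss_sub_runPrev_le hK fun s h1 h2 => hh s h1 ?_
      have := Finset.mem_range.1 ht
      omega
    rw [Finset.sum_const, Finset.card_range, nsmul_eq_mul] at h1
    have h2 : (n : ℝ) ≤ K := (Nat.cast_le.2 hn).trans (Nat.floor_le hK)
    linarith
  · obtain ⟨m, rfl⟩ : ∃ m, n = m + 1 := ⟨n - 1, by omega⟩
    have hm : ⌊K⌋₊ ≤ m := by omega
    have h1 := sum_abs_runLoss_sub_le_of_floor_le hK (h := h) m hm fun s h1 h2 => hh s h1 (by omega)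
    have hcard := (lt_card_Icc_iff hK a m).2 hm
    have hO : |offMax K (Finset.Icc a (a + m)) h| ≤ 1 :=
      abs_offMax_le hK zero_le_one fun i hi =>
        hh i (Finset.mem_Icc.1 hi).1 (by have := (Finset.mem_Icc.1 hi).2; omega)
    have hO' : |offMax K (Finset.Icc a (a + ⌊K⌋₊)) h| ≤ 1 :=
      abs_offMax_le hK zero_le_one fun i hi =>
        hh i (Finset.mem_Icc.1 hi).1 (by have := (Finset.mem_Icc.1 hi).2; omega)
    have h2 := excess_le (S := Finset.Icc a (a + m)) (h := h) (B := 2) zero_le_two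
      (fun s hs => by
        have := hh s (Finset.mem_Icc.1 hs).1 (by have := (Finset.mem_Icc.1 hs).2; omega)
        rw [abs_le] at this hO
        linarith) (card_offMax_lt_le hK hcard)
    have h3 : 0 ≤ runLoss K a h m - offMax K (Finset.Icc a (a + m)) h :=
      sub_nonneg.2 (le_max_left _ _)
    have h4 : (⌊K⌋₊ : ℝ) ≤ K := Nat.floor_le hK
    rw [abs_le] at hO hO'
    have h5 : (2 * K + 1) * (offMax K (Finset.Icc a (a + m)) h -
        offMax K (Finset.Icc a (a + ⌊K⌋₊)) h) ≤ (2 * K + 1) * 2 :=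
      mul_le_mul_of_nonneg_left (by linarith) (by linarith)
    linarith

theorem sum_sq_runLoss_sub_le {K : ℝ} (hK : 0 ≤ K) {a n : ℕ} {h : ℕ → ℝ}
    (hh : ∀ s, a ≤ s → s < a + n → |h s| ≤ 1) :
    ∑ t ∈ Finset.range n, (runLoss K a h t - runPrev K a h t) ^ 2 ≤ 28 * K + 8 := by
  have h1 : ∑ t ∈ Finset.range n, (runLoss K a h t - runPrev K a h t) ^ 2 ≤
      ∑ t ∈ Finset.range n, 2 * |runLoss K a h t - runPrev K a h t| := by
    refine Finset.sum_le_sum fun t ht => ?_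
    have := abs_runLoss_sub_runPrev_le hK (t := t) (a := a) (h := h) fun s h1 h2 => hh s h1 (by
      have := Finset.mem_range.1 ht
      omega)
    rw [← sq_abs, sq]
    exact mul_le_mul_of_nonneg_right this (abs_nonneg _)
  rw [← Finset.mul_sum] at h1
  linarith [sum_abs_runLoss_sub_le hK hh]

/-- If at most `K` values exceed `c`, the offset-max losses exceed `c` in total by `O(K)`. -/
theorem sum_runLoss_le {K : ℝ} (hK : 0 ≤ K) {a n : ℕ} {h : ℕ → ℝ} {c : ℝ} (hc : -1 ≤ c)
    (hh : ∀ s, a ≤ s → s < a + n → |h s| ≤ 1)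
    (hcard : (((Finset.Ico a (a + n)).filter fun s => c < h s).card : ℝ) ≤ K) :
    ∑ t ∈ Finset.range n, runLoss K a h t ≤ n * c + 4 * K := by
  -- Two kinds of rounds can exceed `c`: warm-up rounds, where `offMax` is the default `0`, and
  -- rounds whose own value exceeds `c`. Each kind occurs at most `K` times, and the overshoot is at
  -- most `2` since `c ≥ -1`.
  have h1 : ∀ t ∈ Finset.range n, runLoss K a h t ≤
      c + (if t < ⌊K⌋₊ then 2 else 0) + (if c < h (a + t) then 2 else 0) := by
    intro t ht
    have ht := Finset.mem_range.1 ht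
    have hle := (abs_le.1 (abs_runLoss_le hK (t := t) (a := a) (h := h) fun s h1 h2 =>
      hh s h1 (by omega))).2
    by_cases h2 : t < ⌊K⌋₊
    · rw [if_pos h2]
      split_ifs <;> linarith
    by_cases h3 : c < h (a + t)
    · rw [if_pos h3]
      split_ifs
      linarith
    rw [if_neg h2, if_neg h3, add_zero, add_zero]
    refine max_le (offMax_le_of_card_le ((lt_card_Icc_iff hK a t).2 (not_lt.1 h2)) ?_) (not_lt.1 h3)
    refine le_trans ?_ hcard
    exact_mod_cast Finset.card_le_card (Finset.filter_subset_filter _ fun s hs => by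
      simp only [Finset.mem_Icc, Finset.mem_Ico] at *
      omega)
  refine (Finset.sum_le_sum h1).trans ?_
  rw [Finset.sum_add_distrib, Finset.sum_add_distrib, Finset.sum_const, Finset.card_range,
    nsmul_eq_mul]
  have h2 : ∑ t ∈ Finset.range n, (if t < ⌊K⌋₊ then (2 : ℝ) else 0) ≤ 2 * K := by
    rw [← Finset.sum_filter, Finset.sum_const, nsmul_eq_mul]
    have : ((Finset.range n).filter fun t => t < ⌊K⌋₊).card ≤ ⌊K⌋₊ := by
      conv_rhs => rw [← Finset.card_range ⌊K⌋₊]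
      exact Finset.card_le_card fun s hs => Finset.mem_range.2 (Finset.mem_filter.1 hs).2
    have : (((Finset.range n).filter fun t => t < ⌊K⌋₊).card : ℝ) ≤ ⌊K⌋₊ := by exact_mod_cast this
    linarith [Nat.floor_le hK]
  have h3 : ∑ t ∈ Finset.range n, (if c < h (a + t) then (2 : ℝ) else 0) ≤ 2 * K := by
    have : ∑ t ∈ Finset.range n, (if c < h (a + t) then (2 : ℝ) else 0) =
        ∑ s ∈ Finset.Ico a (a + n), (if c < h s then (2 : ℝ) else 0) := by
      rw [Finset.sum_Ico_eq_sum_range, Nat.add_sub_cancel_left]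
    rw [this, ← Finset.sum_filter, Finset.sum_const, nsmul_eq_mul]
    linarith
  linarith

/-! ### Selected extremizers and optimistic predictions. -/

theorem argminOn_spec {α : Type*} [Nonempty α] {S : Set α} {f : α → ℝ}
    (h : ∃ x ∈ S, ∀ y ∈ S, f x ≤ f y) :
    argminOn S f ∈ S ∧ ∀ y ∈ S, f (argminOn S f) ≤ f y :=
  Classical.epsilon_spec (p := fun x => x ∈ S ∧ ∀ y ∈ S, f x ≤ f y) h

theorem argmaxOn_spec {α : Type*} [Nonempty α] {S : Set α} {f : α → ℝ}
    (h : ∃ x ∈ S, ∀ y ∈ S, f y ≤ f x) :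
    argmaxOn S f ∈ S ∧ ∀ y ∈ S, f y ≤ f (argmaxOn S f) :=
  Classical.epsilon_spec (p := fun x => x ∈ S ∧ ∀ y ∈ S, f y ≤ f x) h

theorem abs_prediction_le {ι : Type*} {y : ℕ → ι → ℝ} {n t : ℕ}
    (hy : ∀ t < n, ∀ i, |y t i| ≤ 1) (ht : t < n) (i : ι) : |prediction y t i| ≤ 1 := by
  cases t with
  | zero => simp [prediction]
  | succ t => exact hy t (by omega) i

/-! ### Scalar relative entropy -/

/-- Fenchel–Young for scalar relative entropy: `log q ≥ 1 - 1/q` at `q = w / (x e^θ)`. -/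
theorem fenchel_entropy {w x : ℝ} (hw : 0 < w) (hx : 0 < x) (θ : ℝ) :
    θ * w - x * (Real.exp θ - 1) ≤ w * Real.log (w / x) - w + x := by
  have hq : 0 < w / (x * Real.exp θ) := by positivity
  have h1 := Real.one_sub_inv_le_log_of_pos hq
  have h2 : Real.log (w / (x * Real.exp θ)) = Real.log (w / x) - θ := by
    rw [← div_div, Real.log_div (by positivity) (by positivity), Real.log_exp]
  rw [h2] at h1
  have h3 := mul_le_mul_of_nonneg_left h1 hw.le
  have h4 : w * (1 - (w / (x * Real.exp θ))⁻¹) = w - x * Real.exp θ := by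
    field_simp
  rw [h4] at h3
  linarith

theorem entropy_nonneg {w x : ℝ} (hw : 0 < w) (hx : 0 < x) :
    0 ≤ w * Real.log (w / x) - w + x := by
  simpa using fenchel_entropy hw hx 0

theorem entropy_le_sq {w x : ℝ} (hw : 0 < w) (hx : 0 < x) :
    w * Real.log (w / x) - w + x ≤ (w - x) ^ 2 / x := by
  have h1 := mul_le_mul_of_nonneg_left (Real.log_le_sub_one_of_pos (div_pos hw hx)) hw.le
  have h2 : w * (w / x - 1) - w + x = (w - x) ^ 2 / x := by
    field_simp
    ring
  linarith

/-- The reason for the correction `32 η v²`: it pays for the instability of the iterate. For `z = v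
+ 32ηv²`, Fenchel–Young at `θ = -ηz` leaves the second-order term `x η z²`. Since `η ≤ 1/128` and
`|v| ≤ 2` give `|z| ≤ 3/2 |v|`, that term is below the correction itself. -/
theorem stability_bound {η v w x : ℝ} (hη : 0 < η) (hη' : η ≤ 1 / 128) (hw : 0 < w) (hx : 0 < x)
    (hv : |v| ≤ 2) :
    (x - w) * (v + 32 * η * v ^ 2) - 1 / η * (w * Real.log (w / x) - w + x) ≤
      x * (32 * η * v ^ 2) := by
  set z := v + 32 * η * v ^ 2 with hz
  have hv2 : v ^ 2 ≤ 2 * |v| := by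
    rw [← sq_abs]
    nlinarith [abs_nonneg v]
  have hzv : |z| ≤ 3 / 2 * |v| := by
    have h1 : |z| ≤ |v| + |32 * η * v ^ 2| := abs_add_le _ _
    rw [abs_of_nonneg (by positivity : 0 ≤ 32 * η * v ^ 2)] at h1
    nlinarith [abs_nonneg v, sq_nonneg v]
  have hηz : |-(η * z)| ≤ 1 := by
    rw [abs_neg, abs_mul, abs_of_pos hη]
    nlinarith [abs_nonneg v, abs_nonneg z]
  have h1 := fenchel_entropy hw hx (-(η * z))
  have h2 := (abs_le.1 (Real.abs_exp_sub_one_sub_id_le hηz)).2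
  have h3 : z ^ 2 ≤ 32 * v ^ 2 := by
    rw [← sq_abs z, ← sq_abs v]
    nlinarith [abs_nonneg v, abs_nonneg z]
  have h4 : (Real.exp (-(η * z)) - 1) ≤ -(η * z) + η ^ 2 * z ^ 2 := by nlinarith
  have h5 := mul_le_mul_of_nonneg_left h4 hx.le
  have h6 : -(η * z) * w - x * (-(η * z) + η ^ 2 * z ^ 2) ≤
      w * Real.log (w / x) - w + x := by linarith
  have h7 := mul_le_mul_of_nonneg_left h6 (one_div_pos.2 hη).le
  have h8 : 1 / η * (-(η * z) * w - x * (-(η * z) + η ^ 2 * z ^ 2)) =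
      (x - w) * z - x * (η * z ^ 2) := by
    field_simp
    ring
  rw [h8] at h7
  have h9 : x * (η * z ^ 2) ≤ x * (32 * η * v ^ 2) := by
    refine mul_le_mul_of_nonneg_left ?_ hx.le
    nlinarith
  linarith

/-! ### The truncated simplex and entropic projections -/

section

variable {ι : Type*} [Fintype ι]

theorem truncSimplex_pos [Nonempty ι] {n : ℕ} (hn : 1 ≤ n) {w : ι → ℝ}
    (hw : w ∈ truncSimplex ι n) (i : ι) : 0 < w i := by
  refine lt_of_lt_of_le ?_ (hw.2 i)
  have : (0 : ℝ) < n := by exact_mod_cast hn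
  have : (0 : ℝ) < Fintype.card ι := by exact_mod_cast Fintype.card_pos
  positivity

theorem uniform_mem_truncSimplex [Nonempty ι] {n : ℕ} (hn : 1 ≤ n) :
    (fun _ : ι => 1 / (Fintype.card ι : ℝ)) ∈ truncSimplex ι n := by
  have hc : (0 : ℝ) < Fintype.card ι := by exact_mod_cast Fintype.card_pos
  have hn' : (1 : ℝ) ≤ n := by exact_mod_cast hn
  refine ⟨?_, fun i => ?_⟩
  · rw [Finset.sum_const, Finset.card_univ, nsmul_eq_mul]
    field_simp
  · exact one_div_le_one_div_of_le hc (by nlinarith)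

theorem convex_truncSimplex (n : ℕ) : Convex ℝ (truncSimplex ι n) := by
  rintro w ⟨hw, hw'⟩ v ⟨hv, hv'⟩ a b ha hb hab
  refine ⟨?_, fun i => ?_⟩
  · simp only [Pi.add_apply, Pi.smul_apply, smul_eq_mul, Finset.sum_add_distrib,
      ← Finset.mul_sum, hw, hv, mul_one, hab]
  · simp only [Pi.add_apply, Pi.smul_apply, smul_eq_mul]
    have := mul_le_mul_of_nonneg_left (hw' i) ha
    have := mul_le_mul_of_nonneg_left (hv' i) hb
    calc 1 / ((Fintype.card ι : ℝ) * n) = (a + b) * (1 / ((Fintype.card ι : ℝ) * n)) := by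
          rw [hab, one_mul]
      _ ≤ _ := by linarith

theorem isCompact_truncSimplex (n : ℕ) : IsCompact (truncSimplex ι n) := by
  refine (isCompact_univ_pi fun _ : ι => isCompact_Icc (a := (0 : ℝ)) (b := 1)).of_isClosed_subset
    ?_ ?_
  · have h1 : IsClosed {w : ι → ℝ | ∑ i, w i = 1} :=
      isClosed_eq (continuous_finsetSum _ fun i _ => continuous_apply i) continuous_const
    have h2 : IsClosed {w : ι → ℝ | ∀ i, 1 / ((Fintype.card ι : ℝ) * n) ≤ w i} := by
      simp only [Set.ofPred_forall]
      exact isClosed_iInter fun i => isClosed_le continuous_const (continuous_apply i)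
    exact h1.inter h2
  · rintro w ⟨hw, hw'⟩ i -
    have h0 : ∀ j, 0 ≤ w j := fun j => le_trans (by positivity) (hw' j)
    exact ⟨h0 i, hw ▸ Finset.single_le_sum (fun j _ => h0 j) (Finset.mem_univ i)⟩

theorem bregman_nonneg {η : ℝ} (hη : 0 < η) {w w' : ι → ℝ} (hw : ∀ i, 0 < w i)
    (hw' : ∀ i, 0 < w' i) : 0 ≤ bregman (fun _ => η) w w' :=
  Finset.sum_nonneg fun i _ =>
    mul_nonneg (one_div_pos.2 hη).le (entropy_nonneg (hw i) (hw' i))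

/-- Truncation keeps every weight away from zero, so the objective is continuous on a compact set
and `argminOn` returns a genuine minimizer. -/
theorem argminOn_truncSimplex_spec [Nonempty ι] {n : ℕ} (hn : 1 ≤ n) (η : ι → ℝ) (z w' : ι → ℝ)
    (hw' : ∀ i, 0 < w' i) :
    (argminOn (truncSimplex ι n) fun w => ∑ i, w i * z i + bregman η w w') ∈ truncSimplex ι n ∧
    ∀ v ∈ truncSimplex ι n,
      (fun w => ∑ i, w i * z i + bregman η w w')
        (argminOn (truncSimplex ι n) fun w => ∑ i, w i * z i + bregman η w w') ≤
      (fun w => ∑ i, w i * z i + bregman η w w') v := by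
  refine argminOn_spec ?_
  obtain ⟨x, hx, hmin⟩ := (isCompact_truncSimplex (ι := ι) n).exists_isMinOn
    ⟨_, uniform_mem_truncSimplex hn⟩
    (f := fun w => ∑ i, w i * z i + bregman η w w') (by
      refine ContinuousOn.add (by fun_prop) ?_
      unfold bregman
      refine continuousOn_finsetSum _ fun i _ => ?_
      refine ContinuousOn.mul continuousOn_const ?_
      refine ContinuousOn.add (ContinuousOn.sub (ContinuousOn.mul (by fun_prop) ?_) (by fun_prop))
        (by fun_prop)
      refine ContinuousOn.log (by fun_prop) fun w hw => ?_
      exact (div_pos (truncSimplex_pos hn hw i) (hw' i)).ne')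
  exact ⟨x, hx, fun y hy => hmin hy⟩

/-- The Bregman proximal inequality for entropic mirror descent on a convex set of positive
vectors. -/
theorem bregman_prox_le {η : ℝ} (hη : 0 < η) {S : Set (ι → ℝ)} (hS : Convex ℝ S)
    (hpos : ∀ w ∈ S, ∀ i, 0 < w i) {z w' x u : ι → ℝ} (hw' : ∀ i, 0 < w' i) (hx : x ∈ S)
    (hmin : ∀ v ∈ S, ∑ i, x i * z i + bregman (fun _ => η) x w' ≤
      ∑ i, v i * z i + bregman (fun _ => η) v w') (hu : u ∈ S) :
    ∑ i, (x i - u i) * z i ≤ bregman (fun _ => η) u w' - bregman (fun _ => η) u x -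
      bregman (fun _ => η) x w' := by
  -- The three-point identity for the entropy, with the gradient difference written as a logarithm.
  have key : ∀ v : ι → ℝ, (∀ i, 0 < v i) →
      bregman (fun _ => η) v w' - bregman (fun _ => η) v x - bregman (fun _ => η) x w' =
      ∑ i, (v i - x i) * (1 / η * Real.log (x i / w' i)) := by
    intro v hv
    simp only [bregman]
    rw [← Finset.sum_sub_distrib, ← Finset.sum_sub_distrib]
    refine Finset.sum_congr rfl fun i _ => ?_
    have hxi := hpos x hx i
    rw [Real.log_div (hv i).ne' (hw' i).ne', Real.log_div (hv i).ne' hxi.ne',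
      Real.log_div hxi.ne' (hw' i).ne']
    ring
  rw [key u (hpos u hu)]
  set A := ∑ i, (u i - x i) * (z i + 1 / η * Real.log (x i / w' i)) with hA
  set c := ∑ i, 1 / η * ((u i - x i) ^ 2 / x i) with hc
  -- First-order optimality without derivatives: moving a fraction `s` from `x` towards `u` changes
  -- the objective by `s A + D(v, x)`, and the chi-square bound `entropy_le_sq` gives `D(v, x) ≤ s²
  -- c`. Small `s` then forces `A ≥ 0`.
  have hAc : ∀ s : ℝ, 0 < s → s ≤ 1 → 0 ≤ A + s * c := by
    intro s hs hs1
    let v : ι → ℝ := fun i => x i + s * (u i - x i)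
    have hv : v ∈ S := by
      have := hS hx hu (sub_nonneg.2 hs1) hs.le (by ring)
      convert this using 1
      ext i
      simp only [v, Pi.add_apply, Pi.smul_apply, smul_eq_mul]
      ring
    have h1 := hmin v hv
    have h2 := key v (hpos v hv)
    have h3 : bregman (fun _ => η) v x ≤ s ^ 2 * c := by
      rw [hc, Finset.mul_sum, bregman]
      refine Finset.sum_le_sum fun i _ => ?_
      have := mul_le_mul_of_nonneg_left (entropy_le_sq (hpos v hv i) (hpos x hx i))
        (one_div_pos.2 hη).le
      refine this.trans (le_of_eq ?_)
      simp only [v]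
      ring
    have h4 : ∑ i, v i * z i - ∑ i, x i * z i +
        ∑ i, (v i - x i) * (1 / η * Real.log (x i / w' i)) = s * A := by
      rw [hA, Finset.mul_sum, ← Finset.sum_sub_distrib, ← Finset.sum_add_distrib]
      refine Finset.sum_congr rfl fun i _ => ?_
      simp only [v]
      ring
    have h5 : 0 ≤ s * (A + s * c) := by nlinarith
    exact nonneg_of_mul_nonneg_right h5 hs
  have hA0 : 0 ≤ A := by
    by_contra hneg
    push Not at hneg
    have hc0 : 0 ≤ c := Finset.sum_nonneg fun i _ =>
      mul_nonneg (one_div_pos.2 hη).le (div_nonneg (sq_nonneg _) (hpos x hx i).le)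
    -- This `s` makes `s c ≤ -A/2`, contradicting `0 ≤ A + s c`; using `c + 1` avoids division by
    -- zero.
    have hs : 0 < min 1 (-A / (2 * (c + 1))) :=
      lt_min one_pos (div_pos (by linarith) (by linarith))
    have h1 := hAc _ hs (min_le_left _ _)
    have h2 : min 1 (-A / (2 * (c + 1))) * c ≤ -A / (2 * (c + 1)) * (c + 1) :=
      mul_le_mul (min_le_right _ _) (by linarith) hc0 (div_nonneg (by linarith) (by linarith))
    have h3 : -A / (2 * (c + 1)) * (c + 1) = -A / 2 := by
      have : c + 1 ≠ 0 := by linarith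
      field_simp
    linarith
  have h6 : A = ∑ i, (u i - x i) * (1 / η * Real.log (x i / w' i)) - ∑ i, (x i - u i) * z i := by
    rw [hA, ← Finset.sum_sub_distrib]
    refine Finset.sum_congr rfl fun i _ => ?_
    ring
  linarith

/-! ### Regret of MsMwC -/

theorem msmwcAux_mem [Nonempty ι] {n : ℕ} (hn : 1 ≤ n) (η : ℕ → ι → ℝ) (y : ℕ → ι → ℝ) (t : ℕ) :
    msmwcAux η n y t ∈ truncSimplex ι n := by
  induction t with
  | zero => exact uniform_mem_truncSimplex hn
  | succ t ih => exact (argminOn_truncSimplex_spec hn _ _ _ (truncSimplex_pos hn ih)).1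

theorem msmwc_mem [Nonempty ι] {n : ℕ} (hn : 1 ≤ n) (η : ℕ → ι → ℝ) (y : ℕ → ι → ℝ) (t : ℕ) :
    msmwc η n y t ∈ truncSimplex ι n :=
  (argminOn_truncSimplex_spec hn _ _ _ (truncSimplex_pos hn (msmwcAux_mem hn η y t))).1

/-- Add two proximal inequalities: the played point against the next auxiliary iterate for the
prediction, and that iterate against `u` for the corrected loss. The divergence from the played
point to the next iterate absorbs the stability term, and the correction at the played point cancels
what remains. The differences in `u` telescope over rounds. -/
theorem msmwc_round_le [Nonempty ι] {n : ℕ} (hn : 1 ≤ n) {η : ℝ} (hη : 0 < η) (hη' : η ≤ 1 / 128)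
    (y : ℕ → ι → ℝ) (t : ℕ) (hy : ∀ i, |y t i - prediction y t i| ≤ 2) {u : ι → ℝ}
    (hu : u ∈ truncSimplex ι n) :
    ∑ i, msmwc (fun _ _ => η) n y t i * y t i ≤
      ∑ i, u i * (y t i + 32 * η * (y t i - prediction y t i) ^ 2) +
      bregman (fun _ => η) u (msmwcAux (fun _ _ => η) n y t) -
      bregman (fun _ => η) u (msmwcAux (fun _ _ => η) n y (t + 1)) := by
  set m := prediction y t with hm
  set w' := msmwcAux (fun _ _ => η) n y t with hw'
  set w'' := msmwcAux (fun _ _ => η) n y (t + 1) with hw''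
  set x := msmwc (fun _ _ => η) n y t with hx
  have mw' : w' ∈ truncSimplex ι n := msmwcAux_mem hn _ _ _
  have mw'' : w'' ∈ truncSimplex ι n := msmwcAux_mem hn _ _ _
  have mx : x ∈ truncSimplex ι n := msmwc_mem hn _ _ _
  have hpos : ∀ w ∈ truncSimplex ι n, ∀ i, 0 < w i := fun w hw => truncSimplex_pos hn hw
  have h1 := bregman_prox_le hη (convex_truncSimplex n) hpos (z := m) (hpos w' mw') mx
    (argminOn_truncSimplex_spec hn _ _ _ (hpos w' mw')).2 mw''
  have h2 := bregman_prox_le hη (convex_truncSimplex n) hpos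
    (z := fun i => y t i + 32 * η * (y t i - m i) ^ 2) (hpos w' mw') mw''
    (argminOn_truncSimplex_spec hn (fun _ => η)
      (fun i => y t i + 32 * η * (y t i - m i) ^ 2) w' (hpos w' mw')).2 hu
  have h3 : ∑ i, (x i - w'' i) * ((y t i - m i) + 32 * η * (y t i - m i) ^ 2) -
      bregman (fun _ => η) w'' x ≤ ∑ i, x i * (32 * η * (y t i - m i) ^ 2) := by
    rw [bregman, ← Finset.sum_sub_distrib]
    exact Finset.sum_le_sum fun i _ =>
      stability_bound hη hη' (hpos w'' mw'' i) (hpos x mx i) (hy i)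
  have h4 := bregman_nonneg hη (hpos x mx) (hpos w' mw')
  have h5 : ∑ i, x i * y t i = ∑ i, (x i - w'' i) * m i +
      ∑ i, (w'' i - u i) * (y t i + 32 * η * (y t i - m i) ^ 2) +
      ∑ i, (x i - w'' i) * ((y t i - m i) + 32 * η * (y t i - m i) ^ 2) -
      ∑ i, x i * (32 * η * (y t i - m i) ^ 2) +
      ∑ i, u i * (y t i + 32 * η * (y t i - m i) ^ 2) := by
    rw [← Finset.sum_add_distrib, ← Finset.sum_add_distrib, ← Finset.sum_sub_distrib,
      ← Finset.sum_add_distrib]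
    refine Finset.sum_congr rfl fun i _ => ?_
    ring
  linarith

theorem bregman_uniform_le [Nonempty ι] {η : ℝ} (hη : 0 < η) {n : ℕ} (hn : 1 ≤ n) {u : ι → ℝ}
    (hu : u ∈ truncSimplex ι n) :
    bregman (fun _ => η) u (fun _ => 1 / (Fintype.card ι : ℝ)) ≤
      Real.log (Fintype.card ι) / η := by
  have hc : (0 : ℝ) < Fintype.card ι := by exact_mod_cast Fintype.card_pos
  have hpos := truncSimplex_pos hn hu
  have hle : ∀ i, u i ≤ 1 := fun i =>
    hu.1 ▸ Finset.single_le_sum (fun j _ => (hpos j).le) (Finset.mem_univ i)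
  rw [bregman, ← Finset.mul_sum, Finset.sum_add_distrib, Finset.sum_sub_distrib, hu.1,
    (uniform_mem_truncSimplex (ι := ι) hn).1, sub_add_cancel, one_div_mul_eq_div]
  refine div_le_div_of_nonneg_right ?_ hη.le
  calc ∑ i, u i * Real.log (u i / (1 / (Fintype.card ι : ℝ)))
      ≤ ∑ i, u i * Real.log (Fintype.card ι) := by
        refine Finset.sum_le_sum fun i _ => mul_le_mul_of_nonneg_left ?_ (hpos i).le
        refine Real.log_le_log (div_pos (hpos i) (by positivity)) ?_
        rw [div_div_eq_mul_div, div_one]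
        nlinarith [hle i]
    _ = Real.log (Fintype.card ι) := by rw [← Finset.sum_mul, hu.1, one_mul]

/-- Second-order regret bound of MsMwC against a single expert. -/
theorem msmwc_regret [Nonempty ι] {n : ℕ} (hn : 1 ≤ n) {η : ℝ} (hη : 0 < η) (hη' : η ≤ 1 / 128)
    (y : ℕ → ι → ℝ) (hy : ∀ t < n, ∀ i, |y t i| ≤ 1) (p : ι) :
    ∑ t ∈ Finset.range n, ∑ i, msmwc (fun _ _ => η) n y t i * y t i ≤
      ∑ t ∈ Finset.range n, y t p + Real.log (Fintype.card ι) / η + 3 +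
      32 * η * ∑ t ∈ Finset.range n, (y t p - prediction y t p) ^ 2 := by
  classical
  have hn' : (1 : ℝ) ≤ n := by exact_mod_cast hn
  have hc : (0 : ℝ) < Fintype.card ι := by exact_mod_cast Fintype.card_pos
  have hd : ∀ t < n, ∀ i, |y t i - prediction y t i| ≤ 2 := fun t ht i => by
    have h1 := hy t ht i
    have h2 := abs_prediction_le hy ht i
    rw [abs_le] at *
    constructor <;> linarith
  have hnle : 1 / (n : ℝ) ≤ 1 := by rw [div_le_one (by linarith)]; exact hn'
  have hnpos : 0 < 1 / (n : ℝ) := by positivity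
  -- A vertex is not in the truncated simplex, so the comparator mixes in `1/n` of the uniform
  -- distribution.
  let u : ι → ℝ := fun i => (1 - 1 / n) * (if i = p then 1 else 0) +
    1 / n * (1 / (Fintype.card ι : ℝ))
  have hsum : ∀ F : ι → ℝ, ∑ i, u i * F i =
      (1 - 1 / n) * F p + 1 / n * ∑ i, 1 / (Fintype.card ι : ℝ) * F i := by
    intro F
    have : ∀ i, u i * F i = (1 - 1 / n) * (if i = p then F i else 0) +
        1 / n * (1 / (Fintype.card ι : ℝ) * F i) := by
      intro i
      simp only [u]
      split_ifs <;> ring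
    simp only [this, Finset.sum_add_distrib, ← Finset.mul_sum, Finset.sum_ite_eq',
      Finset.mem_univ, if_true]
  have hu : u ∈ truncSimplex ι n := by
    refine ⟨?_, fun i => ?_⟩
    · have := hsum fun _ => 1
      simp only [mul_one] at this
      rw [this, (uniform_mem_truncSimplex (ι := ι) hn).1]
      ring
    · have : 0 ≤ (1 - 1 / (n : ℝ)) * (if i = p then 1 else 0) := by
        split_ifs <;> simp only [mul_one, mul_zero, le_refl]
        linarith
      have h2 : 1 / ((Fintype.card ι : ℝ) * n) = 1 / n * (1 / (Fintype.card ι : ℝ)) := by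
        field_simp
      simp only [u]
      linarith
  have hmix : ∀ F : ι → ℝ, ∀ B, (∀ i, F i - F p ≤ B) → ∑ i, u i * F i ≤ F p + 1 / n * B := by
    intro F B hB
    rw [hsum]
    have : ∑ i, 1 / (Fintype.card ι : ℝ) * F i ≤ F p + B := by
      calc ∑ i, 1 / (Fintype.card ι : ℝ) * F i ≤ ∑ i : ι, 1 / (Fintype.card ι : ℝ) * (F p + B) :=
            Finset.sum_le_sum fun i _ =>
              mul_le_mul_of_nonneg_left (by linarith [hB i]) (by positivity)
        _ = F p + B := by
            rw [← Finset.sum_mul, (uniform_mem_truncSimplex (ι := ι) hn).1, one_mul]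
    nlinarith
  have hround : ∀ t ∈ Finset.range n, ∑ i, msmwc (fun _ _ => η) n y t i * y t i ≤
      (y t p + 32 * η * (y t p - prediction y t p) ^ 2 + 1 / n * 3) +
      (bregman (fun _ => η) u (msmwcAux (fun _ _ => η) n y t) -
      bregman (fun _ => η) u (msmwcAux (fun _ _ => η) n y (t + 1))) := by
    intro t ht
    have ht := Finset.mem_range.1 ht
    have h1 := msmwc_round_le hn hη hη' y t (hd t ht) hu
    -- The constant `3` is `2` for a difference of losses plus `1` for the correction (`32 · 4 /
    -- 128`). With weight `1/n` it adds up to `3` over the `n` rounds.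
    have h2 := hmix (fun i => y t i + 32 * η * (y t i - prediction y t i) ^ 2) 3 fun i => by
      have a1 := abs_le.1 (hy t ht i)
      have a2 := abs_le.1 (hy t ht p)
      have a3 : (y t i - prediction y t i) ^ 2 ≤ 4 := by
        have := sq_le_sq' (abs_le.1 (hd t ht i)).1 (abs_le.1 (hd t ht i)).2
        linarith
      have a4 : 32 * η * (y t i - prediction y t i) ^ 2 ≤ 1 := by
        nlinarith [sq_nonneg (y t i - prediction y t i)]
      have a5 : 0 ≤ 32 * η * (y t p - prediction y t p) ^ 2 := by positivity
      linarith
    linarith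
  refine (Finset.sum_le_sum hround).trans ?_
  rw [Finset.sum_add_distrib, Finset.sum_add_distrib, Finset.sum_add_distrib,
    Finset.sum_range_sub', Finset.sum_const, Finset.card_range, nsmul_eq_mul, ← Finset.mul_sum]
  have h1 : bregman (fun _ => η) u (msmwcAux (fun _ _ => η) n y 0) ≤
      Real.log (Fintype.card ι) / η := bregman_uniform_le hη hn hu
  have h2 := bregman_nonneg hη (truncSimplex_pos hn hu)
    (truncSimplex_pos hn (msmwcAux_mem hn (fun _ _ => η) y n))
  have h3 : (n : ℝ) * (1 / n * 3) = 3 := by field_simp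
  linarith

end

/-! ### Intersections of adversary sets -/

/-- Union bound: the members of `I` omit at most `I.card * M` rounds together, too few to cover `G`.
-/
theorem exists_mem_forall_mem {s G : Finset ℕ} {M : ℝ} (hGs : G ⊆ s) (I : Finset (Finset ℕ))
    (hI : ∀ s' ∈ I, s' ⊆ s ∧ (s.card : ℝ) - M ≤ s'.card) (hM : I.card * M < G.card) :
    ∃ t ∈ G, ∀ s' ∈ I, t ∈ s' := by
  classical
  by_contra! hcon
  have hsub : G ⊆ I.biUnion fun s' => s \ s' := by
    intro t ht
    obtain ⟨s', hs', hts'⟩ := hcon t ht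
    exact Finset.mem_biUnion.2 ⟨s', hs', Finset.mem_sdiff.2 ⟨hGs ht, hts'⟩⟩
  have h1 : (G.card : ℝ) ≤ ∑ s' ∈ I, ((s \ s').card : ℝ) := by
    exact_mod_cast (Finset.card_le_card hsub).trans Finset.card_biUnion_le
  have h2 : ∑ s' ∈ I, ((s \ s').card : ℝ) ≤ ∑ s' ∈ I, M := by
    refine Finset.sum_le_sum fun s' hs' => ?_
    have h3 : ((s \ s').card : ℝ) + s'.card = s.card := by
      exact_mod_cast Finset.card_sdiff_add_card_eq_card (hI s' hs').1
    linarith [(hI s' hs').2]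
  rw [Finset.sum_const, nsmul_eq_mul] at h2
  linarith

section

variable {E : Type*} [AddCommGroup E] [Module ℝ E]

theorem mem_qInt {ε : ℝ} {s : Finset ℕ} {ℓ : ℕ → E} {x : E} :
    x ∈ qInt ε s ℓ ↔ ∀ s' ⊆ s, (1 - ε) * (s.card : ℝ) ≤ s'.card →
      x ∈ convexHull ℝ (ℓ '' (s' : Set ℕ)) := by
  constructor
  · intro hx s' h1 h2
    exact Set.mem_sInter.1 hx _ ⟨s', h1, h2, rfl⟩
  · rintro hx _ ⟨s', h1, h2, rfl⟩
    exact hx s' h1 h2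

theorem qInt_subset_convexHull {ε : ℝ} (hε : 0 ≤ ε) (s : Finset ℕ) (ℓ : ℕ → E) :
    qInt ε s ℓ ⊆ convexHull ℝ (ℓ '' (s : Set ℕ)) := fun x hx =>
  mem_qInt.1 hx s (Finset.Subset.refl s) (by nlinarith [(Nat.cast_nonneg s.card : (0 : ℝ) ≤ _)])

theorem qInt_subset {ε : ℝ} (hε : 0 ≤ ε) {s : Finset ℕ} {ℓ : ℕ → E} {A : Set E} (hA : Convex ℝ A)
    (hℓ : ∀ t ∈ s, ℓ t ∈ A) : qInt ε s ℓ ⊆ A :=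
  (qInt_subset_convexHull hε s ℓ).trans (convexHull_min (by
    rintro _ ⟨t, ht, rfl⟩
    exact hℓ t ht) hA)

theorem convex_qInt (ε : ℝ) (s : Finset ℕ) (ℓ : ℕ → E) : Convex ℝ (qInt ε s ℓ) := by
  refine convex_sInter ?_
  rintro _ ⟨s', -, -, rfl⟩
  exact convex_convexHull ℝ _

theorem isCompact_qInt [TopologicalSpace E] [T2Space E] [IsTopologicalAddGroup E]
    [ContinuousSMul ℝ E] {ε : ℝ} (hε : 0 ≤ ε) (s : Finset ℕ) (ℓ : ℕ → E) :
    IsCompact (qInt ε s ℓ) := by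
  have hc : ∀ s' : Finset ℕ, IsCompact (convexHull ℝ (ℓ '' (s' : Set ℕ))) := fun s' =>
    (s'.finite_toSet.image ℓ).isCompact_convexHull (𝕜 := ℝ)
  refine (hc s).of_isClosed_subset (isClosed_sInter ?_) (qInt_subset_convexHull hε s ℓ)
  rintro _ ⟨s', -, -, rfl⟩
  exact (hc s').isClosed

/-- Discarding the same number of rounds from a subfamily gives a smaller intersection set. -/
theorem qInt_mono {ε ε' : ℝ} {s s' : Finset ℕ} (hs : s' ⊆ s) (h : ε * s.card ≤ ε' * s'.card)
    (ℓ : ℕ → E) : qInt ε' s' ℓ ⊆ qInt ε s ℓ := by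
  classical
  intro x hx
  rw [mem_qInt] at hx ⊢
  intro r hr hrc
  refine convexHull_mono (Set.image_mono ?_) (hx (r ∩ s') Finset.inter_subset_right ?_)
  · exact_mod_cast Finset.inter_subset_left
  · have h1 := Finset.card_union_add_card_inter r s'
    have h2 := Finset.card_le_card (Finset.union_subset hr hs)
    have h3 : (r.card : ℝ) + s'.card ≤ s.card + (r ∩ s').card := by exact_mod_cast (by omega)
    linarith

variable [FiniteDimensional ℝ E]

open Module in
/-- A convex set containing more than `dim * (number of discarded rounds)` actions meets the
intersection set. -/
theorem inter_qInt_nonempty {ε : ℝ} {s G : Finset ℕ} {ℓ : ℕ → E} {H : Set E}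
    (hs : (finrank ℝ E + 1) * (ε * s.card) < s.card) (hH : Convex ℝ H) (hGs : G ⊆ s)
    (hG : finrank ℝ E * (ε * s.card) < G.card) (hε : 0 ≤ ε) (hGH : ∀ t ∈ G, ℓ t ∈ H) :
    (H ∩ qInt ε s ℓ).Nonempty := by
  classical
  let Q : Finset (Finset ℕ) := s.powerset.filter fun s' => (1 - ε) * (s.card : ℝ) ≤ s'.card
  let F : Option (Finset ℕ) → Set E := fun o => o.elim H fun s' => convexHull ℝ (ℓ '' (s' : Set ℕ))
  have hM : 0 ≤ ε * s.card := by positivity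
  -- Helly for the hulls of all large subfamilies, with `H` adjoined as `none`. Among `dim + 1` sets
  -- including `H`, only `dim` hulls remain, so the common action can be sought inside `G`; without
  -- `H`, `hs` handles `dim + 1` hulls.
  have key : (⋂ i ∈ Finset.insertNone Q, F i).Nonempty := by
    refine Convex.helly_theorem' (𝕜 := ℝ) ?_ ?_
    · rintro (_ | s') -
      · exact hH
      · exact convex_convexHull ℝ _
    · intro I hI hcard
      have hI' : ∀ s' ∈ Finset.eraseNone I, s' ⊆ s ∧ (s.card : ℝ) - ε * s.card ≤ s'.card := by
        intro s' hs'
        have := Finset.some_mem_insertNone.1 (hI (Finset.mem_eraseNone.1 hs'))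
        rw [Finset.mem_filter, Finset.mem_powerset] at this
        exact ⟨this.1, by linarith [this.2]⟩
      have hfin : ∀ t, (∀ s' ∈ Finset.eraseNone I, t ∈ s') → (none ∈ I → ℓ t ∈ H) →
          ℓ t ∈ ⋂ i ∈ I, F i := by
        intro t h1 h2
        refine Set.mem_iInter₂.2 ?_
        rintro (_ | s') hi
        · exact h2 hi
        · exact subset_convexHull ℝ _ ⟨t, h1 s' (Finset.mem_eraseNone.2 hi), rfl⟩
      by_cases hnone : none ∈ I
      · obtain ⟨t, htG, ht⟩ := exists_mem_forall_mem hGs (Finset.eraseNone I) hI' (by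
          have h1 : (Finset.eraseNone I).card + 1 ≤ finrank ℝ E + 1 := by
            rw [Finset.card_eraseNone_of_mem hnone]
            have := Finset.card_pos.2 ⟨_, hnone⟩
            omega
          have h2 : ((Finset.eraseNone I).card : ℝ) ≤ finrank ℝ E := by
            exact_mod_cast Nat.le_of_succ_le_succ h1
          exact (mul_le_mul_of_nonneg_right h2 hM).trans_lt hG)
        exact ⟨ℓ t, hfin t ht fun _ => hGH t htG⟩
      · obtain ⟨t, -, ht⟩ := exists_mem_forall_mem (Finset.Subset.refl s)
          (Finset.eraseNone I) hI' (by
          have h2 : ((Finset.eraseNone I).card : ℝ) ≤ finrank ℝ E + 1 := by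
            rw [Finset.card_eraseNone_of_not_mem hnone]
            exact_mod_cast hcard
          exact (mul_le_mul_of_nonneg_right h2 hM).trans_lt hs)
        exact ⟨ℓ t, hfin t ht fun h => absurd h hnone⟩
  obtain ⟨x, hx⟩ := key
  rw [Set.mem_iInter₂] at hx
  refine ⟨x, hx none (Finset.none_mem_insertNone), mem_qInt.2 fun s' h1 h2 => ?_⟩
  exact hx (some s') (Finset.some_mem_insertNone.2
    (Finset.mem_filter.2 ⟨Finset.mem_powerset.2 h1, h2⟩))

open Module in
theorem qInt_nonempty {ε : ℝ} {s : Finset ℕ} {ℓ : ℕ → E} (hε : 0 ≤ ε)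
    (hs : (finrank ℝ E + 1) * (ε * s.card) < s.card) : (qInt ε s ℓ).Nonempty := by
  have hM : 0 ≤ ε * s.card := by positivity
  obtain ⟨x, -, hx⟩ := inter_qInt_nonempty (ℓ := ℓ) hs convex_univ (Finset.Subset.refl s)
    (by linarith) hε fun t _ => Set.mem_univ _
  exact ⟨x, hx⟩

open Module in
/-- Few actions exceed the maximum of an affine functional over the intersection set. -/
theorem card_lt_affine_le {ε : ℝ} {s : Finset ℕ} {ℓ : ℕ → E} (hε : 0 ≤ ε)
    (hs : (finrank ℝ E + 1) * (ε * s.card) < s.card) (φ : E →ᵃ[ℝ] ℝ) {c : ℝ}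
    (hc : ∀ x ∈ qInt ε s ℓ, φ x ≤ c) :
    ((s.filter fun t => c < φ (ℓ t)).card : ℝ) ≤ finrank ℝ E * (ε * s.card) := by
  by_contra! hcon
  obtain ⟨x, hxH, hx⟩ := inter_qInt_nonempty (ℓ := ℓ) (H := φ ⁻¹' Set.Ioi c) hs
    ((convex_Ioi c).affine_preimage φ) (Finset.filter_subset _ s) hcon hε
    fun t ht => (Finset.mem_filter.1 ht).2
  exact absurd (hc x hx) (not_le.2 hxH)

end

/-! ### Bi-affine payoffs -/

section

variable {E F G : Type*} [NormedAddCommGroup E] [NormedSpace ℝ E]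
  [NormedAddCommGroup F] [NormedSpace ℝ F] [NormedAddCommGroup G] [InnerProductSpace ℝ G]

/-- A bi-affine map as an affine map of its first argument. -/
noncomputable def evalSnd (u : E →ᵃ[ℝ] (F →ᵃ[ℝ] G)) (x : F) : E →ᵃ[ℝ] G :=
  (LinearMap.toAffineMap
    { toFun := fun f : F →ᵃ[ℝ] G => f x
      map_add' := fun _ _ => rfl
      map_smul' := fun _ _ => rfl }).comp u

@[simp] theorem evalSnd_apply (u : E →ᵃ[ℝ] (F →ᵃ[ℝ] G)) (x : F) (p : E) :
    evalSnd u x p = u p x := rfl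

/-- The unit ball inside `P` makes affine payoffs `1`-Lipschitz: `2 f.linear v = f v - f (-v)` has
norm at most `2` for `‖v‖ ≤ 1`. Replacing an action by a point of the cover thus costs at most
`1/T`. -/
theorem norm_affine_sub_le {P : Set E} (hP : Metric.closedBall 0 1 ⊆ P) (f : E →ᵃ[ℝ] G)
    (hf : ∀ p ∈ P, ‖f p‖ ≤ 1) (p q : E) : ‖f p - f q‖ ≤ dist p q := by
  have hball : ∀ v : E, ‖v‖ ≤ 1 → ‖f.linear v‖ ≤ 1 := by
    intro v hv
    have h1 : f v = f.linear v + f 0 := by simpa using f.map_vadd 0 v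
    have h2 : f (-v) = -f.linear v + f 0 := by simpa using f.map_vadd 0 (-v)
    have h3 : (2 : ℝ) • f.linear v = f v - f (-v) := by
      rw [h1, h2, two_smul]
      abel
    have h4 : ‖(2 : ℝ) • f.linear v‖ ≤ 1 + 1 := by
      rw [h3]
      refine (norm_sub_le _ _).trans (add_le_add (hf _ (hP ?_)) (hf _ (hP ?_))) <;>
        simpa using hv
    rw [norm_smul, Real.norm_eq_abs, abs_two] at h4
    linarith
  have h1 : f p - f q = f.linear (p - q) := by simpa using (f.linearMap_vsub p q).symm
  rw [h1, dist_eq_norm]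
  rcases eq_or_ne (p - q) 0 with h0 | h0
  · simp [h0]
  · have hn : 0 < ‖p - q‖ := norm_pos_iff.2 h0
    have h2 := hball (‖p - q‖⁻¹ • (p - q)) (by
      rw [norm_smul, norm_inv, norm_norm, inv_mul_cancel₀ hn.ne'])
    rw [map_smul, norm_smul, norm_inv, norm_norm, inv_mul_le_iff₀ hn, mul_one] at h2
    exact h2

/-- The scalar payoff in direction `lam` as an affine function of the second argument. -/
noncomputable def scalarSnd (u : E →ᵃ[ℝ] (F →ᵃ[ℝ] G)) (lam : G) (p : E) : F →ᵃ[ℝ] ℝ :=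
  (innerₛₗ ℝ lam).toAffineMap.comp (u p)

@[simp] theorem scalarSnd_apply (u : E →ᵃ[ℝ] (F →ᵃ[ℝ] G)) (lam : G) (p : E) (x : F) :
    scalarSnd u lam p x = inner ℝ lam (u p x) := rfl

/-- The scalar payoff in direction `lam` as an affine function of the first argument. -/
noncomputable def scalarFst (u : E →ᵃ[ℝ] (F →ᵃ[ℝ] G)) (lam : G) (x : F) : E →ᵃ[ℝ] ℝ :=
  (innerₛₗ ℝ lam).toAffineMap.comp (evalSnd u x)

@[simp] theorem scalarFst_apply (u : E →ᵃ[ℝ] (F →ᵃ[ℝ] G)) (lam : G) (p : E) (x : F) :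
    scalarFst u lam x p = inner ℝ lam (u p x) := rfl

theorem affine_convexOn (f : E →ᵃ[ℝ] ℝ) {S : Set E} (hS : Convex ℝ S) : ConvexOn ℝ S f :=
  ⟨hS, fun _ _ _ _ _ _ _ _ hab => (Convex.combo_affine_apply hab).le⟩

theorem affine_concaveOn (f : E →ᵃ[ℝ] ℝ) {S : Set E} (hS : Convex ℝ S) : ConcaveOn ℝ S f :=
  ⟨hS, fun _ _ _ _ _ _ _ _ hab => (Convex.combo_affine_apply hab).ge⟩

variable [FiniteDimensional ℝ E]

theorem bddBelow_scalar_range (u : E →ᵃ[ℝ] (F →ᵃ[ℝ] G)) (lam : G) {P : Set E} (hP : IsCompact P)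
    (x : F) : BddBelow (Set.range fun p : P => (inner ℝ lam (u p x) : ℝ)) := by
  have := (hP.image (scalarFst u lam x).continuous_of_finiteDimensional).bddBelow
  rwa [Set.image_eq_range] at this

variable [FiniteDimensional ℝ F]

theorem biaffine_saddlePoint (u : E →ᵃ[ℝ] (F →ᵃ[ℝ] G)) (lam : G) {P : Set E} {Q : Set F}
    (hP : IsCompact P) (hP' : Convex ℝ P) (hPne : P.Nonempty)
    (hQ : IsCompact Q) (hQ' : Convex ℝ Q) (hQne : Q.Nonempty) :
    ∃ p ∈ P, ∃ x ∈ Q, ∀ q ∈ P, ∀ y ∈ Q,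
      inner ℝ lam (u p y) ≤ inner ℝ lam (u q x) := by
  refine Sion.exists_isSaddlePointOn (f := fun p x => inner ℝ lam (u p x)) hPne hP' hP ?_ ?_
    hQ' hQne hQ ?_ ?_
  · exact fun x _ => ((scalarFst u lam x).continuous_of_finiteDimensional).continuousOn
      |>.lowerSemicontinuousOn
  · exact fun x _ => (affine_convexOn (scalarFst u lam x) hP').quasiconvexOn
  · exact fun p _ => ((scalarSnd u lam p).continuous_of_finiteDimensional).continuousOn
      |>.upperSemicontinuousOn
  · exact fun p _ => (affine_concaveOn (scalarSnd u lam p) hQ').quasiconcaveOn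

/-- The maximin point selected by `argmaxOn` is the second half of a saddle point. -/
theorem argmax_maximin_spec (u : E →ᵃ[ℝ] (F →ᵃ[ℝ] G)) (lam : G) {P : Set E} {Q : Set F}
    (hP : IsCompact P) (hP' : Convex ℝ P) (hPne : P.Nonempty)
    (hQ : IsCompact Q) (hQ' : Convex ℝ Q) (hQne : Q.Nonempty) :
    (argmaxOn Q fun x => ⨅ p : P, (inner ℝ lam (u p x) : ℝ)) ∈ Q ∧
    ∃ p ∈ P, ∀ q ∈ P, ∀ y ∈ Q, inner ℝ lam (u p y) ≤
      inner ℝ lam (u q (argmaxOn Q fun x => ⨅ p : P, (inner ℝ lam (u p x) : ℝ))) := by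
  obtain ⟨p, hp, x, hx, hsad⟩ := biaffine_saddlePoint u lam hP hP' hPne hQ hQ' hQne
  have : Nonempty P := hPne.to_subtype
  have hlow : ∀ y ∈ Q, inner ℝ lam (u p y) ≤ ⨅ q : P, (inner ℝ lam (u q x) : ℝ) := fun y hy =>
    le_ciInf fun q => hsad q q.2 y hy
  have hmax : ∀ y ∈ Q, (⨅ q : P, (inner ℝ lam (u q y) : ℝ)) ≤
      ⨅ q : P, (inner ℝ lam (u q x) : ℝ) := fun y hy =>
    (ciInf_le (bddBelow_scalar_range u lam hP y) ⟨p, hp⟩).trans (hlow y hy)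
  obtain ⟨hmem, hspec⟩ := argmaxOn_spec (S := Q)
    (f := fun x => ⨅ p : P, (inner ℝ lam (u p x) : ℝ)) ⟨x, hx, hmax⟩
  exact ⟨hmem, p, hp, fun q hq y hy => (hlow y hy).trans ((hspec x hx).trans
    (ciInf_le (bddBelow_scalar_range u lam hP _) ⟨q, hq⟩))⟩

end

/-! ### Online gradient ascent on the unit ball -/

section

variable {V : Type*} [NormedAddCommGroup V] [InnerProductSpace ℝ V]

theorem norm_ballProj_le (x : V) : ‖ballProj x‖ ≤ 1 := by
  have h : 0 < max 1 ‖x‖ := lt_max_of_lt_left one_pos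
  rw [ballProj, norm_smul, norm_inv, Real.norm_of_nonneg h.le, inv_mul_le_iff₀ h, mul_one]
  exact le_max_right _ _

theorem norm_ballProj_sub_sq_le (x : V) {μ : V} (hμ : ‖μ‖ ≤ 1) :
    ‖ballProj x - μ‖ ^ 2 ≤ ‖x - μ‖ ^ 2 := by
  rcases le_or_gt ‖x‖ 1 with hx | hx
  · rw [ballProj, max_eq_left hx, inv_one, one_smul]
  · have hr : 0 < ‖x‖ := by linarith
    rw [ballProj, max_eq_right hx.le, norm_sub_sq_real, norm_sub_sq_real, norm_smul, norm_inv,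
      norm_norm, inv_mul_cancel₀ hr.ne', real_inner_smul_left]
    have h1 : inner ℝ x μ ≤ ‖x‖ := (real_inner_le_norm x μ).trans (by nlinarith)
    have h2 : 0 ≤ 1 - ‖x‖⁻¹ := sub_nonneg.2 (inv_le_one_of_one_le₀ hx.le)
    have h3 := mul_le_mul_of_nonneg_left h1 h2
    have h4 : (1 - ‖x‖⁻¹) * ‖x‖ = ‖x‖ - 1 := by
      rw [sub_mul, inv_mul_cancel₀ hr.ne', one_mul]
    nlinarith [sq_nonneg (‖x‖ - 1)]

theorem sum_inner_sub_le_of_gradient_ascent {lam g : ℕ → V} {L : ℕ} (h0 : ‖lam 0‖ ≤ 1)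
    (hlam : ∀ e, lam (e + 1) = ballProj (lam e + (1 / Real.sqrt ((e : ℝ) + 1)) • g e))
    (hg : ∀ e < L, ‖g e‖ ≤ 4) {μ : V} (hμ : ‖μ‖ ≤ 1) :
    ∑ e ∈ Finset.range L, inner ℝ (μ - lam e) (g e) ≤ 18 * Real.sqrt L := by
  have hnorm : ∀ e, ‖lam e‖ ≤ 1 := fun e => by
    cases e with
    | zero => exact h0
    | succ e => rw [hlam]; exact norm_ballProj_le _
  -- Potential `√k/2 · ‖λ_k - μ‖²`. Each increment of `√k` is charged `2` for the squared diameter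
  -- `4` and `16` for the gradient term `8/√(k+1)`, giving `18`.
  have key : ∀ k ≤ L, ∑ e ∈ Finset.range k, inner ℝ (μ - lam e) (g e) ≤
      18 * Real.sqrt k - Real.sqrt k / 2 * ‖lam k - μ‖ ^ 2 := by
    intro k
    induction k with
    | zero => simp
    | succ k ih =>
      intro hk
      have ih := ih (by omega)
      rw [Finset.sum_range_succ]
      push_cast
      set r := Real.sqrt k with hr
      set s := Real.sqrt ((k : ℝ) + 1) with hs
      have hr0 : 0 ≤ r := Real.sqrt_nonneg _
      have hs0 : 0 < s := Real.sqrt_pos.2 (by positivity)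
      have hr2 : r ^ 2 = k := Real.sq_sqrt (Nat.cast_nonneg k)
      have hs2 : s ^ 2 = k + 1 := Real.sq_sqrt (by positivity)
      have hrs : r ≤ s := Real.sqrt_le_sqrt (by linarith)
      have h1 : ‖lam (k + 1) - μ‖ ^ 2 ≤ ‖lam k - μ‖ ^ 2 - 2 * (1 / s) * inner ℝ (μ - lam k) (g k) +
          (1 / s) ^ 2 * 16 := by
        rw [hlam]
        refine (norm_ballProj_sub_sq_le _ hμ).trans ?_
        rw [show lam k + (1 / s) • g k - μ = (lam k - μ) + (1 / s) • g k by abel,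
          norm_add_sq_real, norm_smul, mul_pow, real_inner_smul_right,
          show lam k - μ = -(μ - lam k) by abel, inner_neg_left, norm_neg, Real.norm_eq_abs,
          sq_abs]
        have h2 : ‖g k‖ ^ 2 ≤ 16 := by
          have := hg k (by omega)
          nlinarith [norm_nonneg (g k)]
        have h3 := mul_le_mul_of_nonneg_left h2 (sq_nonneg (1 / s))
        linarith
      have h2 : s / 2 * ‖lam (k + 1) - μ‖ ^ 2 ≤
          s / 2 * ‖lam k - μ‖ ^ 2 - inner ℝ (μ - lam k) (g k) + 8 / s := by
        have := mul_le_mul_of_nonneg_left h1 (by positivity : 0 ≤ s / 2)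
        refine this.trans (le_of_eq ?_)
        field_simp
        ring
      have h3 : ‖lam k - μ‖ ^ 2 ≤ 4 := by
        have := norm_sub_le (lam k) μ
        have := hnorm k
        nlinarith [norm_nonneg (lam k - μ)]
      have h4 : 8 / s ≤ 16 * (s - r) := by
        rw [div_le_iff₀ hs0]
        nlinarith [mul_nonneg (sub_nonneg.2 hrs) (sub_nonneg.2 hrs)]
      have h5 := mul_le_mul_of_nonneg_left h3 (by linarith : 0 ≤ (s - r) / 2)
      linarith
  have := key L le_rfl
  have h1 : 0 ≤ Real.sqrt L / 2 * ‖lam L - μ‖ ^ 2 := by positivity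
  linarith

/-- Compare with the normalized sum of the gains as fixed direction: its total gain is the norm of
the sum. A zero sum gives the zero vector, which is also admissible. -/
theorem norm_sum_le_of_gradient_ascent {lam g : ℕ → V} {L : ℕ} (h0 : ‖lam 0‖ ≤ 1)
    (hlam : ∀ e, lam (e + 1) = ballProj (lam e + (1 / Real.sqrt ((e : ℝ) + 1)) • g e))
    (hg : ∀ e < L, ‖g e‖ ≤ 4) :
    ‖∑ e ∈ Finset.range L, g e‖ ≤
      ∑ e ∈ Finset.range L, inner ℝ (lam e) (g e) + 18 * Real.sqrt L := by
  set v := ∑ e ∈ Finset.range L, g e with hv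
  have hμ : ‖‖v‖⁻¹ • v‖ ≤ 1 := by
    rw [norm_smul, norm_inv, norm_norm]
    exact inv_mul_le_one
  have h1 := sum_inner_sub_le_of_gradient_ascent h0 hlam hg hμ
  simp only [inner_sub_left, Finset.sum_sub_distrib] at h1
  rw [← inner_sum, ← hv, real_inner_smul_left, real_inner_self_eq_norm_sq] at h1
  have h2 : ‖v‖⁻¹ * ‖v‖ ^ 2 = ‖v‖ := by
    rcases eq_or_ne ‖v‖ 0 with h | h
    · simp [h]
    · field_simp
  linarith

end

/-! ### Covers -/

open MeasureTheory Metric Module ENNReal in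
-- Volume packing: the disjoint `δ`-balls around the points lie in the ball of radius `R + δ`.
theorem card_mul_pow_le_of_separated {E : Type*} [NormedAddCommGroup E] [NormedSpace ℝ E]
    [FiniteDimensional ℝ E] {δ R : ℝ} (hδ : 0 < δ) (hR : 0 ≤ R) (s : Finset E)
    (hs : ∀ c ∈ s, ‖c‖ ≤ R) (h : ∀ c ∈ s, ∀ d ∈ s, c ≠ d → 2 * δ ≤ dist c d) :
    (s.card : ℝ) * δ ^ finrank ℝ E ≤ (R + δ) ^ finrank ℝ E := by
  borelize E
  let μ : Measure E := Measure.addHaar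
  have ρpos : 0 < R + δ := by linarith
  set A := ⋃ c ∈ s, ball (c : E) δ with hA
  have D : Set.Pairwise (s : Set E) (Function.onFun Disjoint fun c => ball (c : E) δ) := by
    rintro c hc d hd hcd
    apply ball_disjoint_ball
    linarith [h c hc d hd hcd]
  have A_subset : A ⊆ ball (0 : E) (R + δ) := by
    refine Set.iUnion₂_subset fun x hx => ?_
    apply ball_subset_ball'
    rw [dist_zero_right]
    linarith [hs x hx]
  have I : (s.card : ℝ≥0∞) * ENNReal.ofReal (δ ^ finrank ℝ E) * μ (ball 0 1) ≤
      ENNReal.ofReal ((R + δ) ^ finrank ℝ E) * μ (ball 0 1) :=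
    calc
      (s.card : ℝ≥0∞) * ENNReal.ofReal (δ ^ finrank ℝ E) * μ (ball 0 1) = μ A := by
        rw [hA, measure_biUnion_finset D fun c _ => measurableSet_ball]
        simp only [μ.addHaar_ball_of_pos _ hδ]
        simp only [Finset.sum_const, nsmul_eq_mul, mul_assoc]
      _ ≤ μ (ball (0 : E) (R + δ)) := measure_mono A_subset
      _ = ENNReal.ofReal ((R + δ) ^ finrank ℝ E) * μ (ball 0 1) := by
        simp only [μ.addHaar_ball_of_pos _ ρpos]
  have J : (s.card : ℝ≥0∞) * ENNReal.ofReal (δ ^ finrank ℝ E) ≤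
      ENNReal.ofReal ((R + δ) ^ finrank ℝ E) :=
    (ENNReal.mul_le_mul_iff_left (measure_ball_pos _ _ zero_lt_one).ne' measure_ball_lt_top.ne).1 I
  have K := ENNReal.toReal_le_of_le_ofReal (pow_nonneg ρpos.le _) J
  rwa [ENNReal.toReal_mul, ENNReal.toReal_natCast, ENNReal.toReal_ofReal (by positivity)] at K

/-- A `1/T`-separated subset of maximal cardinality is a cover, since an uncovered point could be
added. Packing bounds its base by `2nT + 1 ≤ 3n²T`. -/
theorem exists_isActionCover {n T : ℕ} (hn : 1 ≤ n) (hT : 1 ≤ T)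
    {P : Set (EuclideanSpace ℝ (Fin n))} (hP : P ⊆ Metric.closedBall 0 (n : ℝ)) :
    ∃ N, IsActionCover T P N := by
  classical
  have hT' : (1 : ℝ) ≤ T := by exact_mod_cast hT
  have hn' : (1 : ℝ) ≤ n := by exact_mod_cast hn
  have hT0 : (0 : ℝ) < T := by linarith
  let good : Finset (EuclideanSpace ℝ (Fin n)) → Prop := fun s =>
    (s : Set (EuclideanSpace ℝ (Fin n))) ⊆ P ∧ ∀ c ∈ s, ∀ d ∈ s, c ≠ d → 1 / (T : ℝ) ≤ dist c d
  have hbound : ∀ s, good s → (s.card : ℝ) ≤ (3 * (n : ℝ) ^ 2 * T) ^ n := by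
    intro s hs
    have h1 := card_mul_pow_le_of_separated (δ := 1 / (2 * T)) (R := n) (by positivity)
      (by positivity) s (fun c hc => by simpa using hP (hs.1 hc)) (fun c hc d hd hcd => by
        have := hs.2 c hc d hd hcd
        have e : 2 * (1 / (2 * (T : ℝ))) = 1 / T := by field_simp
        rwa [e])
    rw [finrank_euclideanSpace_fin] at h1
    have h2 : (s.card : ℝ) ≤ ((n + 1 / (2 * T)) / (1 / (2 * T))) ^ n := by
      rw [div_pow, le_div_iff₀ (by positivity)]
      exact h1
    refine h2.trans (pow_le_pow_left₀ (by positivity) ?_ n)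
    have e : ((n : ℝ) + 1 / (2 * T)) / (1 / (2 * T)) = 2 * (n * T) + 1 := by field_simp
    rw [e]
    have h3 : 1 ≤ (n : ℝ) * T := by nlinarith
    nlinarith
  have hbound' : ∀ s, good s → s.card ≤ ⌊(3 * (n : ℝ) ^ 2 * T) ^ n⌋₊ := fun s hs =>
    Nat.le_floor (hbound s hs)
  obtain ⟨m, ⟨N, hN, rfl⟩, hmax⟩ : ∃ m, (∃ s, good s ∧ s.card = m) ∧
      ∀ s, good s → s.card ≤ m := by
    have hP0 : ∃ m, ∃ s, good s ∧ s.card = m := ⟨0, ∅, ⟨by simp, by simp⟩, rfl⟩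
    refine ⟨Nat.findGreatest (fun m => ∃ s, good s ∧ s.card = m) ⌊(3 * (n : ℝ) ^ 2 * T) ^ n⌋₊,
      ?_, fun s hs => Nat.le_findGreatest (hbound' s hs) ⟨s, hs, rfl⟩⟩
    exact Nat.findGreatest_spec (P := fun m => ∃ s, good s ∧ s.card = m) (Nat.zero_le _)
      ⟨∅, ⟨by simp, by simp⟩, rfl⟩
  refine ⟨N, hN.1, fun p hp => ?_, hbound N hN⟩
  by_contra! hcon
  have hpN : p ∉ N := fun h => by
    have := hcon p h
    rw [dist_self] at this
    exact absurd this (not_lt.2 (by positivity))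
  have := hmax (insert p N) ⟨by
      rw [Finset.coe_insert]
      exact Set.insert_subset hp hN.1, fun c hc d hd hcd => by
      rw [Finset.mem_insert] at hc hd
      rcases hc with rfl | hc <;> rcases hd with rfl | hd
      · exact absurd rfl hcd
      · exact (hcon d hd).le
      · rw [dist_comm]; exact (hcon c hc).le
      · exact hN.2 c hc d hd hcd⟩
  rw [Finset.card_insert_of_notMem hpN] at this
  omega

/-! ### Epochs -/

theorem epochStart_mono (T L : ℕ) : Monotone (epochStart T L) := fun _ _ h =>
  Nat.div_le_div_right (Nat.mul_le_mul_right T h)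

theorem epochStart_self (T : ℕ) {L : ℕ} (hL : 1 ≤ L) : epochStart T L L = T :=
  Nat.mul_div_cancel_left T hL

theorem epochStart_zero (T L : ℕ) : epochStart T L 0 = 0 := by simp [epochStart]

theorem card_epoch (T L e : ℕ) :
    (epoch T L e).card = epochStart T L (e + 1) - epochStart T L e := Nat.card_Ico _ _

theorem epochStart_add_card (T L e : ℕ) :
    epochStart T L e + (epoch T L e).card = epochStart T L (e + 1) := by
  rw [card_epoch]
  exact Nat.add_sub_cancel' (epochStart_mono T L (Nat.le_succ e))

theorem one_le_card_epoch {T L : ℕ} (hL : 1 ≤ L) (hLT : L ≤ T) (e : ℕ) :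
    1 ≤ (epoch T L e).card := by
  have h : epochStart T L e + 1 ≤ epochStart T L (e + 1) := by
    rw [epochStart, epochStart, ← Nat.add_div_right _ (by omega)]
    refine Nat.div_le_div_right ?_
    rw [Nat.succ_mul]
    omega
  rw [card_epoch]
  omega

theorem card_epoch_bounds (T : ℕ) {L : ℕ} (hL : 1 ≤ L) (e : ℕ) :
    (T : ℝ) / L - 1 ≤ (epoch T L e).card ∧ ((epoch T L e).card : ℝ) ≤ T / L + 1 := by
  have hL' : (0 : ℝ) < L := by exact_mod_cast hL
  have hb : ∀ m : ℕ, (m : ℝ) / L - 1 < (m / L : ℕ) ∧ ((m / L : ℕ) : ℝ) ≤ m / L := fun m => by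
    refine ⟨?_, Nat.cast_div_le⟩
    have := Nat.lt_floor_add_one ((m : ℝ) / L)
    rw [Nat.floor_div_eq_div] at this
    linarith
  have h1 : (epochStart T L e : ℝ) + (epoch T L e).card = epochStart T L (e + 1) := by
    exact_mod_cast epochStart_add_card T L e
  have h2 := hb (e * T)
  have h3 := hb ((e + 1) * T)
  have h4 : (((e + 1) * T : ℕ) : ℝ) / L = ((e * T : ℕ) : ℝ) / L + T / L := by
    push_cast
    ring
  rw [h4] at h3
  change (epochStart T L e : ℝ) + (epoch T L e).card = (((e + 1) * T / L : ℕ) : ℝ) at h1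
  have h5 : (epochStart T L e : ℝ) = ((e * T / L : ℕ) : ℝ) := rfl
  constructor <;> linarith [h2.1, h2.2, h3.1, h3.2]

theorem epoch_subset_range (T : ℕ) {L e : ℕ} (he : e < L) : epoch T L e ⊆ Finset.range T := by
  intro t ht
  have h1 := (Finset.mem_Ico.1 ht).2
  have h2 := epochStart_mono T L (Nat.succ_le_of_lt he)
  rw [epochStart_self T (by omega)] at h2
  exact Finset.mem_range.2 (h1.trans_le h2)

theorem sum_epochs {M : Type*} [AddCommMonoid M] (T : ℕ) {L : ℕ} (hL : 1 ≤ L) (F : ℕ → M) :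
    ∑ e ∈ Finset.range L, ∑ t ∈ epoch T L e, F t = ∑ t ∈ Finset.range T, F t := by
  have key : ∀ k, ∑ e ∈ Finset.range k, ∑ t ∈ epoch T L e, F t =
      ∑ t ∈ Finset.Ico 0 (epochStart T L k), F t := by
    intro k
    induction k with
    | zero => simp [epochStart_zero]
    | succ k ih =>
      rw [Finset.sum_range_succ, ih]
      exact Finset.sum_Ico_consecutive F (Nat.zero_le _) (epochStart_mono T L (Nat.le_succ k))
  rw [key, epochStart_self T hL, Finset.range_eq_Ico]

theorem epochStart_epochOf_le (T L t : ℕ) : epochStart T L (epochOf T L t) ≤ t :=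
  Nat.findGreatest_spec (P := fun e => epochStart T L e ≤ t) (Nat.zero_le L)
    (by rw [epochStart_zero]; exact Nat.zero_le t)

theorem epochOf_eq {T L e t : ℕ} (he : e < L) (ht : t ∈ epoch T L e) : epochOf T L t = e := by
  have h := Finset.mem_Ico.1 ht
  refine le_antisymm ?_ (Nat.le_findGreatest he.le h.1)
  by_contra! hlt
  have h1 : epochStart T L (e + 1) ≤ epochStart T L (epochOf T L t) := epochStart_mono T L hlt
  exact absurd (h.2.trans_le (h1.trans (epochStart_epochOf_le T L t))) (lt_irrefl t)

/-! ### Legitimacy of the learner -/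

theorem prediction_congr {ι : Type*} {y y' : ℕ → ι → ℝ} {t : ℕ} (h : ∀ s < t, y s = y' s) :
    prediction y t = prediction y' t := by
  cases t with
  | zero => rfl
  | succ t => exact h t (Nat.lt_succ_self t)

/-- `argminOn` depends only on its set and objective, so equal past losses give the same iterate,
ties included. -/
theorem msmwcAux_congr {ι : Type*} [Fintype ι] (η : ℕ → ι → ℝ) (n : ℕ) {y y' : ℕ → ι → ℝ} {t : ℕ}
    (h : ∀ s < t, y s = y' s) : msmwcAux η n y t = msmwcAux η n y' t := by
  induction t with
  | zero => rfl
  | succ t ih =>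
    have h' : ∀ s < t, y s = y' s := fun s hs => h s (by omega)
    rw [msmwcAux, msmwcAux, ih h', h t (Nat.lt_succ_self t), prediction_congr h']

theorem msmwc_congr {ι : Type*} [Fintype ι] (η : ℕ → ι → ℝ) (n : ℕ) {y y' : ℕ → ι → ℝ} {t : ℕ}
    (h : ∀ s < t, y s = y' s) : msmwc η n y t = msmwc η n y' t := by
  rw [msmwc, msmwc, msmwcAux_congr η n h, prediction_congr h]

theorem qInt_congr {V : Type*} [AddCommGroup V] [Module ℝ V] (ε : ℝ) {s : Finset ℕ} {ℓ ℓ' : ℕ → V}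
    (h : ∀ t ∈ s, ℓ t = ℓ' t) : qInt ε s ℓ = qInt ε s ℓ' := by
  ext x
  rw [mem_qInt, mem_qInt]
  refine forall₃_congr fun s' hs' _ => ?_
  rw [Set.image_congr fun t ht => h t (hs' ht)]

section

variable {dP dL d : ℕ}
  {u : EuclideanSpace ℝ (Fin dP) → EuclideanSpace ℝ (Fin dL) → EuclideanSpace ℝ (Fin d)}
  {ℓ ℓ' : ℕ → EuclideanSpace ℝ (Fin dL)}

theorem offsetLoss_congr (K : ℝ) (lam : EuclideanSpace ℝ (Fin d)) (a : ℕ) {t : ℕ}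
    (h : ∀ s ≤ t, ℓ s = ℓ' s) (p : EuclideanSpace ℝ (Fin dP)) :
    offsetLoss u K ℓ lam a t p = offsetLoss u K ℓ' lam a t p := by
  rw [offsetLoss, offsetLoss, h t le_rfl]
  congr 1
  refine offMax_congr fun s hs => ?_
  rw [h s (Finset.mem_Icc.1 hs).2]

theorem innerPlay_congr (T L : ℕ) (K : ℝ) (N : Finset (EuclideanSpace ℝ (Fin dP)))
    (η : ℕ → N → ℝ) (lam : EuclideanSpace ℝ (Fin d)) {e t : ℕ} (h : ∀ s < t, ℓ s = ℓ' s) :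
    innerPlay u T L K N η ℓ lam e t = innerPlay u T L K N η ℓ' lam e t := by
  rw [innerPlay, innerPlay, msmwc_congr]
  intro s hs
  funext q
  exact offsetLoss_congr K lam _ (fun r hr => h r (by omega)) _

theorem direction_congr (P : Set (EuclideanSpace ℝ (Fin dP)))
    (pstar : EuclideanSpace ℝ (Fin dL) → EuclideanSpace ℝ (Fin dP))
    (T L : ℕ) (ε K : ℝ) (N : Finset (EuclideanSpace ℝ (Fin dP))) (η : ℕ → N → ℝ)
    (lam₀ : EuclideanSpace ℝ (Fin d)) {e : ℕ} (h : ∀ s < epochStart T L e, ℓ s = ℓ' s) :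
    direction P u pstar T L ε K N η lam₀ ℓ e = direction P u pstar T L ε K N η lam₀ ℓ' e := by
  induction e with
  | zero => rfl
  | succ e ih =>
    have ih := ih fun s hs => h s (hs.trans_le (epochStart_mono T L (Nat.le_succ e)))
    have hep : ∀ t ∈ epoch T L e, ℓ t = ℓ' t := fun t ht => h t (Finset.mem_Ico.1 ht).2
    have htar : ∀ lam, epochTarget P u pstar T L ε ℓ lam e =
        epochTarget P u pstar T L ε ℓ' lam e := fun lam => by
      rw [epochTarget, epochTarget, epochInt, epochInt, qInt_congr _ hep]
    have hsum : ∀ lam, ∑ t ∈ epoch T L e, (u (innerPlay u T L K N η ℓ lam e t) (ℓ t) -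
          epochTarget P u pstar T L ε ℓ lam e) =
        ∑ t ∈ epoch T L e, (u (innerPlay u T L K N η ℓ' lam e t) (ℓ' t) -
          epochTarget P u pstar T L ε ℓ' lam e) := fun lam =>
      Finset.sum_congr rfl fun t ht => by
        rw [hep t ht, htar, innerPlay_congr T L K N η _ fun s hs =>
          h s (hs.trans (Finset.mem_Ico.1 ht).2)]
    rw [direction, direction, ih, hsum]

theorem epochLearner_congr (P : Set (EuclideanSpace ℝ (Fin dP)))
    (pstar : EuclideanSpace ℝ (Fin dL) → EuclideanSpace ℝ (Fin dP))
    (T L : ℕ) (ε K : ℝ) (N : Finset (EuclideanSpace ℝ (Fin dP))) (η : ℕ → N → ℝ)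
    (lam₀ : EuclideanSpace ℝ (Fin d)) {t : ℕ} (h : ∀ s < t, ℓ s = ℓ' s) :
    epochLearner P u pstar T L ε K N η lam₀ ℓ t =
      epochLearner P u pstar T L ε K N η lam₀ ℓ' t := by
  rw [epochLearner, epochLearner, direction_congr P pstar T L ε K N η lam₀ fun s hs =>
    h s (hs.trans_le (epochStart_epochOf_le T L t)), innerPlay_congr T L K N η _ h]

theorem innerPlay_mem {P : Set (EuclideanSpace ℝ (Fin dP))} (hP : Convex ℝ P) {T L : ℕ} (K : ℝ)
    {N : Finset (EuclideanSpace ℝ (Fin dP))} (hN : (N : Set (EuclideanSpace ℝ (Fin dP))) ⊆ P)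
    (hNne : N.Nonempty) (η : ℕ → N → ℝ) (lam : EuclideanSpace ℝ (Fin d)) {e : ℕ} (t : ℕ)
    (he : 1 ≤ (epoch T L e).card) : innerPlay u T L K N η ℓ lam e t ∈ P := by
  have : Nonempty N := hNne.to_subtype
  have hmem := msmwc_mem he η
    (fun s q => offsetLoss u K ℓ lam (epochStart T L e) (epochStart T L e + s) q)
    (t - epochStart T L e)
  exact hP.sum_mem (fun i _ => (truncSimplex_pos he hmem i).le) hmem.1 fun i _ => hN i.2

end

/-! ### One epoch -/

section

variable {dP dL d : ℕ}

theorem abs_inner_payoff_le {V : Type*} [NormedAddCommGroup V] [InnerProductSpace ℝ V] {lam v : V}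
    (hlam : ‖lam‖ ≤ 1) (hv : ‖v‖ ≤ 1) : |inner ℝ lam v| ≤ 1 :=
  (abs_real_inner_le_norm lam v).trans (mul_le_one₀ hlam (norm_nonneg _) hv)

variable {P : Set (EuclideanSpace ℝ (Fin dP))} {𝓛 : Set (EuclideanSpace ℝ (Fin dL))}
  {u : EuclideanSpace ℝ (Fin dP) →ᵃ[ℝ]
    (EuclideanSpace ℝ (Fin dL) →ᵃ[ℝ] EuclideanSpace ℝ (Fin d))}
  {pstar : EuclideanSpace ℝ (Fin dL) → EuclideanSpace ℝ (Fin dP)}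
  {ℓ : ℕ → EuclideanSpace ℝ (Fin dL)} {ε : ℝ} {T L D : ℕ}

theorem epochInt_nonempty (hε : 0 ≤ ε) {e : ℕ} (hcard : 1 ≤ (epoch T L e).card)
    (hlen : ((dL : ℝ) + 1) * (ε * T) < (epoch T L e).card) : (epochInt T L ε ℓ e).Nonempty := by
  have hn : (0 : ℝ) < (epoch T L e).card := by exact_mod_cast hcard
  refine qInt_nonempty (by positivity) ?_
  rwa [finrank_euclideanSpace_fin, div_mul_cancel₀ _ hn.ne']

theorem epochInt_subset_qInt (ε : ℝ) {e : ℕ} (he : e < L) (hcard : 1 ≤ (epoch T L e).card) :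
    epochInt T L ε ℓ e ⊆ qInt ε (Finset.range T) ℓ := by
  have hn : (0 : ℝ) < (epoch T L e).card := by exact_mod_cast hcard
  refine qInt_mono (epoch_subset_range T he) ?_ ℓ
  rw [div_mul_cancel₀ _ hn.ne', Finset.card_range]

/-- The response function may be arbitrary on `𝓛`: the saddle inequality holds against every action
in `P`, in particular against `pstar x`. -/
theorem epochTarget_spec (hPc : IsCompact P) (hP : Convex ℝ P) (hPne : P.Nonempty)
    (hpstar : ∀ x ∈ 𝓛, pstar x ∈ P) (h𝓛 : Convex ℝ 𝓛)
    (hε : 0 ≤ ε) {e : ℕ} (hcard : 1 ≤ (epoch T L e).card)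
    (hlen : ((dL : ℝ) + 1) * (ε * T) < (epoch T L e).card)
    (hℓ : ∀ t ∈ epoch T L e, ℓ t ∈ 𝓛) (lam : EuclideanSpace ℝ (Fin d)) :
    (∃ x ∈ epochInt T L ε ℓ e, x ∈ 𝓛 ∧
      epochTarget P (fun p x => u p x) pstar T L ε ℓ lam e = u (pstar x) x) ∧
    ∃ p ∈ P, ∀ y ∈ epochInt T L ε ℓ e, inner ℝ lam (u p y) ≤
      inner ℝ lam (epochTarget P (fun p x => u p x) pstar T L ε ℓ lam e) := by
  have hε' : 0 ≤ ε * T / ((epoch T L e).card : ℝ) := by positivity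
  obtain ⟨hmem, p, hp, hsad⟩ := argmax_maximin_spec u lam hPc hP hPne
    (isCompact_qInt hε' (epoch T L e) ℓ) (convex_qInt _ (epoch T L e) ℓ)
    (epochInt_nonempty (ℓ := ℓ) hε hcard hlen)
  have h𝓛' := qInt_subset hε' h𝓛 hℓ hmem
  exact ⟨⟨_, hmem, h𝓛', rfl⟩, p, hp, fun y hy => hsad _ (hpstar _ h𝓛') y hy⟩

/-- In each epoch the learner nearly attains the maximin value in the direction of the epoch. -/
theorem epoch_regret (hPc : IsCompact P) (hP : Convex ℝ P) (hP1 : Metric.closedBall 0 1 ⊆ P)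
    (h𝓛 : Convex ℝ 𝓛) (hu : ∀ p ∈ P, ∀ x ∈ 𝓛, ‖u p x‖ ≤ 1) (hpstar : ∀ x ∈ 𝓛, pstar x ∈ P)
    (hε : 0 ≤ ε) (hD : dL ≤ D) {e : ℕ} (he : e < L) (hcard : 1 ≤ (epoch T L e).card)
    (hlen : ((dL : ℝ) + 1) * (ε * T) < (epoch T L e).card)
    (hℓ : ∀ t < T, ℓ t ∈ 𝓛) {N : Finset (EuclideanSpace ℝ (Fin dP))} (hN : IsActionCover T P N)
    {lam : EuclideanSpace ℝ (Fin d)} (hlam : ‖lam‖ ≤ 1) :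
    ∑ t ∈ epoch T L e, inner ℝ lam
      (u (innerPlay (fun p x => u p x) T L (ε * D * T) N (fun _ _ => 1 / 128) ℓ lam e t) (ℓ t) -
        epochTarget P (fun p x => u p x) pstar T L ε ℓ lam e) ≤
      128 * Real.log N.card + 11 * (ε * D * T) + 6 := by
  set n := (epoch T L e).card with hn
  set a := epochStart T L e with ha
  set K := ε * D * T with hKdef
  set v := inner ℝ lam (epochTarget P (fun p x => u p x) pstar T L ε ℓ lam e) with hv
  have hK : 0 ≤ K := by positivity
  have hnpos : (0 : ℝ) < n := by exact_mod_cast hcard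
  have hPne : P.Nonempty := ⟨0, hP1 (by simp)⟩
  have hep : epoch T L e = Finset.Ico a (a + n) := by
    rw [hn, ha, epochStart_add_card, epoch]
  have hT : ∀ t ∈ Finset.Ico a (a + n), t < T := fun t ht =>
    Finset.mem_range.1 (epoch_subset_range T he (hep ▸ ht))
  have hnT : (n : ℝ) ≤ T := by
    have := Finset.card_le_card (epoch_subset_range T he)
    rw [Finset.card_range] at this
    exact_mod_cast this
  have hTpos : (0 : ℝ) < T := hnpos.trans_le hnT
  obtain ⟨⟨x, hxQ, hx𝓛, htar⟩, p₀, hp₀, hsad⟩ := epochTarget_spec (u := u) hPc hP hPne hpstar h𝓛 hε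
    hcard hlen (fun t ht => hℓ t (hT t (hep ▸ ht))) lam
  obtain ⟨p, hpN, hdist⟩ := hN.2.1 p₀ hp₀
  have hNne : Nonempty N := ⟨⟨p, hpN⟩⟩
  have hbd : ∀ q ∈ P, ∀ s, a ≤ s → s < a + n → |inner ℝ lam (u q (ℓ s))| ≤ 1 :=
    fun q hq s h1 h2 => abs_inner_payoff_le hlam
      (hu q hq _ (hℓ s (hT s (Finset.mem_Ico.2 ⟨h1, h2⟩))))
  have hv1 : -1 ≤ v := by
    rw [hv, htar]
    exact (abs_le.1 (abs_inner_payoff_le hlam (hu _ (hpstar x hx𝓛) x hx𝓛))).1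
  have hclose : ∀ s ∈ Finset.Ico a (a + n),
      inner ℝ lam (u p (ℓ s)) ≤ inner ℝ lam (u p₀ (ℓ s)) + 1 / (T : ℝ) := by
    intro s hs
    have h1 := norm_affine_sub_le hP1 (evalSnd u (ℓ s))
      (fun q hq => hu q hq _ (hℓ s (hT s hs))) p p₀
    have h2 := real_inner_le_norm lam (u p (ℓ s) - u p₀ (ℓ s))
    rw [inner_sub_right] at h2
    have h3 : ‖lam‖ * ‖u p (ℓ s) - u p₀ (ℓ s)‖ ≤ 1 * ‖u p (ℓ s) - u p₀ (ℓ s)‖ :=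
      mul_le_mul_of_nonneg_right hlam (norm_nonneg _)
    simp only [evalSnd_apply] at h1
    rw [dist_comm] at hdist
    linarith
  -- Helly bounds the number of exceedances for `p₀`; the level is raised by `1/T` to pass to its
  -- neighbour `p` in the cover.
  have hcount : (((Finset.Ico a (a + n)).filter fun s =>
      v + 1 / (T : ℝ) < inner ℝ lam (u p (ℓ s))).card : ℝ) ≤ K := by
    have hε' : 0 ≤ ε * T / (n : ℝ) := div_nonneg (mul_nonneg hε hTpos.le) hnpos.le
    have h1 := card_lt_affine_le (s := epoch T L e) (ℓ := ℓ) (ε := ε * T / n) hε'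
      (by rwa [finrank_euclideanSpace_fin, ← hn, div_mul_cancel₀ _ hnpos.ne'])
      (scalarSnd u lam p₀) (c := v) (fun y hy => hsad y hy)
    rw [← hn, div_mul_cancel₀ _ hnpos.ne', finrank_euclideanSpace_fin, hep] at h1
    have h2 : (((Finset.Ico a (a + n)).filter fun s =>
        v + 1 / (T : ℝ) < inner ℝ lam (u p (ℓ s))).card : ℝ) ≤
        ((Finset.Ico a (a + n)).filter fun s => v < scalarSnd u lam p₀ (ℓ s)).card := by
      refine Nat.cast_le.2 (Finset.card_le_card fun s hs => ?_)
      rw [Finset.mem_filter] at hs ⊢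
      refine ⟨hs.1, ?_⟩
      rw [scalarSnd_apply]
      linarith [hclose s hs.1, hs.2]
    have h3 : (dL : ℝ) * (ε * T) ≤ K := by
      rw [hKdef, mul_right_comm, mul_comm]
      exact mul_le_mul_of_nonneg_left (by exact_mod_cast hD) (by positivity)
    linarith
  let y : ℕ → N → ℝ := fun s q => offsetLoss (fun p x => u p x) K ℓ lam a (a + s) q
  have hy : ∀ (q : N) s, y s q = runLoss K a (fun s => inner ℝ lam (u q (ℓ s))) s :=
    fun _ _ => rfl
  have hpred : ∀ (q : N) s, prediction y s q =
      runPrev K a (fun s => inner ℝ lam (u q (ℓ s))) s := by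
    intro q s
    cases s <;> rfl
  have hybd : ∀ t < n, ∀ q, |y t q| ≤ 1 := fun t ht q =>
    abs_runLoss_le hK fun s h1 h2 => hbd q (hN.1 q.2) s h1 (by omega)
  have hreg := msmwc_regret hcard (η := 1 / 128) (by norm_num) le_rfl y hybd ⟨p, hpN⟩
  have hpath := sum_sq_runLoss_sub_le hK (hbd p (hN.1 hpN))
  have hcomp := sum_runLoss_le hK (c := v + 1 / T)
    (by have : 0 < 1 / (T : ℝ) := by positivity
        linarith) (hbd p (hN.1 hpN)) hcount
  simp only [hy ⟨p, hpN⟩, hpred ⟨p, hpN⟩] at hreg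
  -- The payoff is affine in the action, so the barycenter earns the average payoff of the experts;
  -- the second entry of the maximum in `offsetLoss` makes the surrogate dominate it.
  have hplay : ∑ t ∈ epoch T L e, inner ℝ lam
      (u (innerPlay (fun p x => u p x) T L K N (fun _ _ => 1 / 128) ℓ lam e t) (ℓ t)) ≤
      ∑ t ∈ Finset.range n, ∑ i, msmwc (fun _ _ => 1 / 128) n y t i * y t i := by
    rw [hep, Finset.sum_Ico_eq_sum_range, Nat.add_sub_cancel_left]
    refine Finset.sum_le_sum fun t _ => ?_
    have hmem := msmwc_mem hcard (fun _ _ => 1 / 128) y t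
    have h1 := (affine_convexOn (scalarFst u lam (ℓ (a + t))) convex_univ).map_sum_le
      (t := Finset.univ) (w := msmwc (fun _ _ => 1 / 128) n y t)
      (p := fun q : N => (q : EuclideanSpace ℝ (Fin dP)))
      (fun i _ => (truncSimplex_pos hcard hmem i).le) hmem.1 (fun _ _ => Set.mem_univ _)
    have h2 : innerPlay (fun p x => u p x) T L K N (fun _ _ => 1 / 128) ℓ lam e (a + t) =
        ∑ q : N, msmwc (fun _ _ => 1 / 128) n y t q • (q : EuclideanSpace ℝ (Fin dP)) := by
      rw [innerPlay, ← ha, Nat.add_sub_cancel_left]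
    rw [h2]
    refine h1.trans (Finset.sum_le_sum fun q _ => ?_)
    rw [smul_eq_mul]
    exact mul_le_mul_of_nonneg_left (le_max_right _ _) (truncSimplex_pos hcard hmem q).le
  simp only [inner_sub_right, Finset.sum_sub_distrib, Finset.sum_const, nsmul_eq_mul]
  rw [← hv, ← hn]
  rw [Fintype.card_coe] at hreg
  -- Tally: regret gives `128 log |N| + 3` and `(28K + 8)/4 = 7K + 2`, exceedances give `4K`, and
  -- the cover gives `1`.
  have h1 : (n : ℝ) * (v + 1 / T) ≤ n * v + 1 := by
    have : (n : ℝ) * (1 / T) ≤ 1 := by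
      rw [mul_one_div]
      exact div_le_one_of_le₀ hnT hTpos.le
    linarith
  have h2 : Real.log (N.card : ℝ) / (1 / 128) = 128 * Real.log N.card := by ring
  rw [h2] at hreg
  linarith

end

/-! ### The distance bound -/

section

variable {dP dL d : ℕ} {P : Set (EuclideanSpace ℝ (Fin dP))} {𝓛 : Set (EuclideanSpace ℝ (Fin dL))}
  {u : EuclideanSpace ℝ (Fin dP) →ᵃ[ℝ]
    (EuclideanSpace ℝ (Fin dL) →ᵃ[ℝ] EuclideanSpace ℝ (Fin d))}
  {pstar : EuclideanSpace ℝ (Fin dL) → EuclideanSpace ℝ (Fin dP)}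
  {ℓ : ℕ → EuclideanSpace ℝ (Fin dL)} {ε : ℝ} {T L D : ℕ}

theorem IsActionCover.nonempty {N : Finset (EuclideanSpace ℝ (Fin dP))} (hN : IsActionCover T P N)
    (hP : P.Nonempty) : N.Nonempty := by
  obtain ⟨p, hp⟩ := hP
  obtain ⟨q, hq, -⟩ := hN.2.1 p hp
  exact ⟨q, hq⟩

theorem epochLearner_mem (hP : Convex ℝ P) (hPne : P.Nonempty) (hL : 1 ≤ L) (hLT : L ≤ T) (K : ℝ)
    {N : Finset (EuclideanSpace ℝ (Fin dP))} (hN : IsActionCover T P N) (η : ℕ → N → ℝ)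
    (lam₀ : EuclideanSpace ℝ (Fin d)) (t : ℕ) :
    epochLearner P (fun p x => u p x) pstar T L ε K N η lam₀ ℓ t ∈ P :=
  innerPlay_mem hP K hN.1 (hN.nonempty hPne) η _ t (one_le_card_epoch hL hLT _)

theorem qInt_range_nonempty (hε : 0 ≤ ε) (hε' : ε < 1 / ((dL : ℝ) + 1)) (hT : 1 ≤ T) :
    (qInt ε (Finset.range T) ℓ).Nonempty := by
  refine qInt_nonempty hε ?_
  rw [finrank_euclideanSpace_fin, Finset.card_range]
  have hT' : (0 : ℝ) < T := by exact_mod_cast hT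
  have h1 : ((dL : ℝ) + 1) * ε < 1 := by
    rw [lt_div_iff₀ (by positivity)] at hε'
    linarith
  nlinarith

theorem norm_average_le {V : Type*} [NormedAddCommGroup V] [NormedSpace ℝ V] {T : ℕ} (hT : 1 ≤ T)
    {v : ℕ → V} (hv : ∀ t < T, ‖v t‖ ≤ 1) : ‖(1 / (T : ℝ)) • ∑ t ∈ Finset.range T, v t‖ ≤ 1 := by
  have hT' : (0 : ℝ) < T := by exact_mod_cast hT
  have h1 : ‖∑ t ∈ Finset.range T, v t‖ ≤ T := by
    refine (norm_sum_le_of_le (Finset.range T) (f := v) (n := fun _ => 1)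
      fun t ht => hv t (Finset.mem_range.1 ht)).trans ?_
    simp
  rw [norm_smul, Real.norm_of_nonneg (by positivity), one_div, inv_mul_le_iff₀ hT', mul_one]
  exact h1

theorem infDist_le_two {S : Set (EuclideanSpace ℝ (Fin d))} {v s : EuclideanSpace ℝ (Fin d)}
    (hv : ‖v‖ ≤ 1) (hs : s ∈ S) (hs' : ‖s‖ ≤ 1) : Metric.infDist v S ≤ 2 := by
  refine (Metric.infDist_le_dist_of_mem hs).trans ?_
  rw [dist_eq_norm]
  linarith [norm_sub_le v s]

theorem infDist_epochLearner_le (hPc : IsCompact P) (hP : Convex ℝ P)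
    (hP1 : Metric.closedBall 0 1 ⊆ P)
    (h𝓛 : Convex ℝ 𝓛) (hu : ∀ p ∈ P, ∀ x ∈ 𝓛, ‖u p x‖ ≤ 1) (hpstar : ∀ x ∈ 𝓛, pstar x ∈ P)
    (hε : 0 ≤ ε) (hD : dL ≤ D) (hL : 1 ≤ L) (hLT : L ≤ T)
    (hlen : ((dL : ℝ) + 1) * (ε * T) < T / L - 1)
    (hℓ : ∀ t < T, ℓ t ∈ 𝓛) {N : Finset (EuclideanSpace ℝ (Fin dP))} (hN : IsActionCover T P N)
    {lam₀ : EuclideanSpace ℝ (Fin d)} (hlam : ‖lam₀‖ ≤ 1) :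
    Metric.infDist ((1 / (T : ℝ)) • ∑ t ∈ Finset.range T,
      u (epochLearner P (fun p x => u p x) pstar T L ε (ε * D * T) N (fun _ _ => 1 / 128) lam₀ ℓ t)
        (ℓ t))
      (targetSet (fun p x => u p x) pstar (qInt ε (Finset.range T) ℓ)) ≤
    (L : ℝ) / T * (128 * Real.log N.card + 11 * (ε * D * T) + 6) + 18 / Real.sqrt L := by
  have hL' : (0 : ℝ) < L := by exact_mod_cast hL
  have hT' : (0 : ℝ) < T := by exact_mod_cast hL.trans hLT
  have hPne : P.Nonempty := ⟨0, hP1 (by simp)⟩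
  set lam : ℕ → EuclideanSpace ℝ (Fin d) := direction P (fun p x => u p x) pstar T L ε (ε * D * T) N
    (fun _ _ => 1 / 128) lam₀ ℓ with hlamdef
  set play : ℕ → ℕ → EuclideanSpace ℝ (Fin dP) := fun e t =>
    innerPlay (fun p x => u p x) T L (ε * D * T) N (fun _ _ => 1 / 128) ℓ (lam e) e t with hplay
  set tar : ℕ → EuclideanSpace ℝ (Fin d) := fun e =>
    epochTarget P (fun p x => u p x) pstar T L ε ℓ (lam e) e with htar
  set g : ℕ → EuclideanSpace ℝ (Fin d) := fun e => ((L : ℝ) / T) • ∑ t ∈ epoch T L e,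
      (u (play e t) (ℓ t) - tar e) with hg
  have hcard : ∀ e, 1 ≤ (epoch T L e).card := one_le_card_epoch hL hLT
  have hlen' : ∀ e, ((dL : ℝ) + 1) * (ε * T) < (epoch T L e).card := fun e =>
    hlen.trans_le (card_epoch_bounds T hL e).1
  have hlam_succ : ∀ e, lam (e + 1) =
      ballProj (lam e + (1 / Real.sqrt ((e : ℝ) + 1)) • g e) := fun e => rfl
  have hlam1 : ∀ e, ‖lam e‖ ≤ 1 := fun e => by
    cases e with
    | zero => exact hlam
    | succ e => exact norm_ballProj_le _
  have hℓe : ∀ e < L, ∀ t ∈ epoch T L e, ℓ t ∈ 𝓛 := fun e he t ht =>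
    hℓ t (Finset.mem_range.1 (epoch_subset_range T he ht))
  have htarget : ∀ e < L, tar e ∈ targetSet (fun p x => u p x) pstar
      (qInt ε (Finset.range T) ℓ) ∧ ‖tar e‖ ≤ 1 := by
    intro e he
    obtain ⟨⟨x, hx, hx𝓛, hxe⟩, -⟩ := epochTarget_spec (u := u) hPc hP hPne hpstar h𝓛 hε (hcard e)
      (hlen' e) (hℓe e he) (lam e)
    have hxe : tar e = u (pstar x) x := hxe
    rw [hxe]
    exact ⟨subset_convexHull ℝ _ ⟨x, epochInt_subset_qInt ε he (hcard e) hx, rfl⟩,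
      hu _ (hpstar x hx𝓛) x hx𝓛⟩
  have hg4 : ∀ e < L, ‖g e‖ ≤ 4 := by
    intro e he
    have h1 : ‖∑ t ∈ epoch T L e, (u (play e t) (ℓ t) - tar e)‖ ≤ (epoch T L e).card * 2 := by
      refine (norm_sum_le_of_le _ (n := fun _ => (2 : ℝ)) fun t ht => ?_).trans ?_
      · refine (norm_sub_le _ _).trans ?_
        have := hu (play e t) (innerPlay_mem hP _ hN.1 (hN.nonempty hPne) _ _ t (hcard e))
          (ℓ t) (hℓe e he t ht)
        linarith [(htarget e he).2]
      · rw [Finset.sum_const, nsmul_eq_mul]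
    rw [hg]
    simp only
    rw [norm_smul, Real.norm_of_nonneg (by positivity)]
    have h2 : (L : ℝ) / T * (T / L + 1) ≤ 2 := by
      have h3 : (L : ℝ) / T ≤ 1 := div_le_one_of_le₀ (by exact_mod_cast hLT) hT'.le
      have h4 : (L : ℝ) / T * (T / L) = 1 := by field_simp
      linarith
    have h3 := mul_le_mul_of_nonneg_left
      (h1.trans (mul_le_mul_of_nonneg_right (card_epoch_bounds T hL e).2 zero_le_two))
      (by positivity : 0 ≤ (L : ℝ) / T)
    linarith
  have hasc := norm_sum_le_of_gradient_ascent (lam := lam) (g := g) hlam hlam_succ hg4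
  have hinner : ∀ e ∈ Finset.range L, inner ℝ (lam e) (g e) ≤
      (L : ℝ) / T * (128 * Real.log N.card + 11 * (ε * D * T) + 6) := by
    intro e he
    have he := Finset.mem_range.1 he
    rw [hg]
    simp only
    rw [real_inner_smul_right, inner_sum]
    exact mul_le_mul_of_nonneg_left (epoch_regret hPc hP hP1 h𝓛 hu hpstar hε hD he (hcard e)
      (hlen' e) hℓ hN (hlam1 e)) (by positivity)
  have hinner' := Finset.sum_le_sum hinner
  rw [Finset.sum_const, Finset.card_range, nsmul_eq_mul] at hinner'
  -- Weights proportional to epoch lengths sum to one. With them the factor `L/T` in `g` makes the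
  -- difference exactly `(1/L) ∑ g_e`, even for unequal epochs.
  have hmem : ∑ e ∈ Finset.range L, (((epoch T L e).card : ℝ) / T) • tar e ∈
      targetSet (fun p x => u p x) pstar (qInt ε (Finset.range T) ℓ) := by
    refine (convex_convexHull ℝ _).sum_mem (fun e _ => by positivity) ?_
      fun e he => (htarget e (Finset.mem_range.1 he)).1
    have h1 := sum_epochs T hL fun _ => (1 : ℝ)
    simp only [Finset.sum_const, nsmul_eq_mul, mul_one, Finset.card_range] at h1
    rw [← Finset.sum_div, h1, div_self hT'.ne']
  refine (Metric.infDist_le_dist_of_mem hmem).trans ?_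
  have hdiff : (1 / (T : ℝ)) • ∑ t ∈ Finset.range T,
      u (epochLearner P (fun p x => u p x) pstar T L ε (ε * D * T) N (fun _ _ => 1 / 128) lam₀ ℓ t)
        (ℓ t) - ∑ e ∈ Finset.range L, (((epoch T L e).card : ℝ) / T) • tar e =
      (1 / (L : ℝ)) • ∑ e ∈ Finset.range L, g e := by
    rw [← sum_epochs T hL, Finset.smul_sum, Finset.smul_sum, ← Finset.sum_sub_distrib]
    refine Finset.sum_congr rfl fun e he => ?_
    have h1 : ∑ t ∈ epoch T L e, u (epochLearner P (fun p x => u p x) pstar T L ε (ε * D * T) N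
        (fun _ _ => 1 / 128) lam₀ ℓ t) (ℓ t) = ∑ t ∈ epoch T L e, u (play e t) (ℓ t) := by
      refine Finset.sum_congr rfl fun t ht => ?_
      rw [epochLearner, epochOf_eq (Finset.mem_range.1 he) ht]
    rw [h1, hg]
    simp only
    rw [smul_smul, Finset.sum_sub_distrib, Finset.sum_const, ← Nat.cast_smul_eq_nsmul ℝ, smul_sub,
      smul_smul, show 1 / (L : ℝ) * (L / T) = 1 / T by field_simp, one_div_mul_eq_div]
  rw [dist_eq_norm, hdiff, norm_smul, Real.norm_of_nonneg (by positivity)]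
  have h2 := mul_le_mul_of_nonneg_left (hasc.trans (add_le_add_left hinner' _))
    (by positivity : 0 ≤ 1 / (L : ℝ))
  refine h2.trans (le_of_eq ?_)
  have hs : 0 < Real.sqrt L := Real.sqrt_pos.2 hL'
  have hs2 : Real.sqrt L ^ 2 = L := Real.sq_sqrt hL'.le
  rw [mul_add, ← mul_assoc, one_div_mul_cancel hL'.ne', one_mul]
  congr 1
  rw [← hs2, Real.sqrt_sq hs.le]
  field_simp

end

/-! ### Tuning -/

/-- The number of epochs: `(T / dP)^(2/3)` or `(ε D)^(-2/3)`, whichever is smaller, up to constants. -/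
noncomputable def epochCount (T dP D : ℕ) (ε : ℝ) : ℕ :=
  max 1 (min T ⌊1 / (((dP : ℝ) / T) ^ (1 / 3 : ℝ) + (ε * D) ^ (1 / 3 : ℝ)) ^ 2⌋₊)

theorem one_le_epochCount (T dP D : ℕ) (ε : ℝ) : 1 ≤ epochCount T dP D ε := le_max_left _ _

theorem epochCount_le {T : ℕ} (hT : 1 ≤ T) (dP D : ℕ) (ε : ℝ) : epochCount T dP D ε ≤ T :=
  max_le hT (min_le_left _ _)

theorem rpow_third_pow_three {x : ℝ} (hx : 0 ≤ x) : (x ^ (1 / 3 : ℝ)) ^ 3 = x := by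
  rw [← Real.rpow_natCast, ← Real.rpow_mul hx]
  norm_num

theorem log_card_cover_le {T dP m : ℕ} (hm : 1 ≤ m) (hdP : 1 ≤ dP) (hT : dP ≤ T)
    (h : (m : ℝ) ≤ (3 * (dP : ℝ) ^ 2 * T) ^ dP) :
    Real.log m ≤ dP * (3 * (1 + Real.log T)) := by
  have hdP' : (1 : ℝ) ≤ dP := by exact_mod_cast hdP
  have hT' : (dP : ℝ) ≤ T := by exact_mod_cast hT
  have h1 := Real.log_le_log (by exact_mod_cast hm) h
  rw [Real.log_pow] at h1
  refine h1.trans (mul_le_mul_of_nonneg_left ?_ (by positivity))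
  have hT0 : (0 : ℝ) < T := by linarith
  have h2 : 3 * (dP : ℝ) ^ 2 * T ≤ 3 * T ^ 3 := by
    have : (dP : ℝ) ^ 2 ≤ T ^ 2 := pow_le_pow_left₀ (by linarith) hT' 2
    nlinarith
  have h3 := Real.log_le_log (by positivity) h2
  have e : Real.log (3 * (T : ℝ) ^ 3) = Real.log 3 + (3 : ℕ) * Real.log T := by
    rw [Real.log_mul (by norm_num) (by positivity), Real.log_pow]
  rw [e] at h3
  have h4 := Real.log_le_sub_one_of_pos (show (0 : ℝ) < 3 by norm_num)
  push_cast at h3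
  linarith

/-- The tuned bound, in terms of `a = (dP / T)^(1/3)` and `b = (ε D)^(1/3)`. -/
theorem tuned_bound {a b Λ lg T L dP : ℝ} (ha : 0 < a) (hb : 0 ≤ b) (hT : 0 < T) (hdP : 1 ≤ dP)
    (haT : a ^ 3 = dP / T) (hL : 1 ≤ L)
    (hL1 : L ≤ 1 / (a + b) ^ 2) (hL2 : 1 / (a + b) ^ 2 - 1 < L) (hab : a + b ≤ 1 / 4)
    (hΛ : 0 ≤ Λ) (hlg : lg ≤ dP * (3 * (1 + Λ))) :
    L / T * (128 * lg + 11 * (b ^ 3 * T) + 6) + 18 / Real.sqrt L ≤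
      500 * a * (1 + Λ) + 500 * b := by
  have hρ : 0 < a + b := by linarith
  have hLρ : L * (a + b) ^ 2 ≤ 1 := by rwa [le_div_iff₀ (by positivity)] at hL1
  -- Both `L a²` and `L b²` are at most `L (a + b)² ≤ 1`, so a cube loses two of its three factors.
  have hLa : L * a ^ 3 ≤ a := by
    have : a ^ 2 ≤ (a + b) ^ 2 := pow_le_pow_left₀ ha.le (by linarith) 2
    have : L * a ^ 2 ≤ 1 := le_trans (mul_le_mul_of_nonneg_left this (by linarith)) hLρ
    nlinarith
  have hLb : L * b ^ 3 ≤ b := by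
    have : b ^ 2 ≤ (a + b) ^ 2 := pow_le_pow_left₀ hb (by linarith) 2
    have : L * b ^ 2 ≤ 1 := le_trans (mul_le_mul_of_nonneg_left this (by linarith)) hLρ
    nlinarith
  have hLT : L / T * dP ≤ a := by
    rw [div_mul_eq_mul_div, mul_div_assoc, ← haT]
    exact hLa
  have hLT0 : 0 ≤ L / T := by positivity
  have h1 : L / T * lg ≤ a * (3 * (1 + Λ)) := by
    have := mul_le_mul_of_nonneg_left hlg hLT0
    rw [← mul_assoc] at this
    exact this.trans (mul_le_mul_of_nonneg_right hLT (by linarith))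
  have h2 : L / T * 6 ≤ 6 * a := by nlinarith
  have h3 : L / T * (b ^ 3 * T) = L * b ^ 3 := by field_simp
  have hs : 18 / Real.sqrt L ≤ 36 * (a + b) := by
    have hs0 : 0 < Real.sqrt L := Real.sqrt_pos.2 (by linarith)
    have hsL : 1 / (2 * (a + b)) ≤ Real.sqrt L := by
      refine Real.le_sqrt_of_sq_le ?_
      -- As `1/(a+b)² ≥ 16`, losing `1` to the floor still leaves `L ≥ 1/(4(a+b)²)`.
      have h4 : (1 / (2 * (a + b))) ^ 2 = 1 / (a + b) ^ 2 / 4 := by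
        field_simp
        ring
      have h5 : 16 ≤ 1 / (a + b) ^ 2 := by
        rw [le_div_iff₀ (by positivity)]
        nlinarith
      linarith
    rw [div_le_iff₀ hs0]
    have h6 := mul_le_mul_of_nonneg_left hsL (by linarith : 0 ≤ 36 * (a + b))
    have h7 : 36 * (a + b) * (1 / (2 * (a + b))) = 18 := by
      field_simp
      norm_num
    linarith
  have h8 : 0 ≤ a * Λ := mul_nonneg ha.le hΛ
  nlinarith

end Opportunistic

/-! ### The main theorem: a trivial regime and a tuned regime. -/

theorem mainTheorem2 :
    ∃ (C : ℝ) (L : ℕ → ℕ → ℕ → ℝ → ℕ) (η : ℕ → ℕ → ℕ → ℝ → ℝ),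
      0 < C ∧
      (∀ (T dP D : ℕ) (ε : ℝ), 1 ≤ T → 1 ≤ L T dP D ε ∧ L T dP D ε ≤ T) ∧
      (∀ (T dP D : ℕ) (ε : ℝ), 0 < η T dP D ε) ∧
      ∀ (dP dL d D : ℕ), 1 ≤ dP → 1 ≤ D → dL ≤ D →
      ∀ (P : Set (EuclideanSpace ℝ (Fin dP))) (𝓛 : Set (EuclideanSpace ℝ (Fin dL))),
        IsCompact P → Convex ℝ P →
        Metric.closedBall 0 1 ⊆ P → P ⊆ Metric.closedBall 0 (dP : ℝ) →
        IsCompact 𝓛 → Convex ℝ 𝓛 →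
      ∀ (u : EuclideanSpace ℝ (Fin dP) →ᵃ[ℝ]
            (EuclideanSpace ℝ (Fin dL) →ᵃ[ℝ] EuclideanSpace ℝ (Fin d))),
        (∀ p ∈ P, ∀ x ∈ 𝓛, ‖u p x‖ ≤ 1) →
      ∀ (pstar : EuclideanSpace ℝ (Fin dL) → EuclideanSpace ℝ (Fin dP)),
        (∀ x ∈ 𝓛, pstar x ∈ P) →
      ∀ (ε : ℝ), 0 ≤ ε → ε < 1 / ((dL : ℝ) + 1) →
      ∀ (T : ℕ), 1 ≤ T →
        (∃ N : Finset (EuclideanSpace ℝ (Fin dP)), Opportunistic.IsActionCover T P N) ∧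
        ∀ (N : Finset (EuclideanSpace ℝ (Fin dP))), Opportunistic.IsActionCover T P N →
        ∀ (lam₀ : EuclideanSpace ℝ (Fin d)), ‖lam₀‖ ≤ 1 →
          Opportunistic.IsStatisticallyOpportunistic P 𝓛 (fun p x => u p x) pstar ε T
            (Opportunistic.epochLearner P (fun p x => u p x) pstar T (L T dP D ε) ε
              (ε * D * T) N (fun _ _ => η T dP D ε) lam₀)
            (C * ((dP : ℝ) / T) ^ (1 / 3 : ℝ) * (1 + Real.log T))
            (C * (ε * D) ^ (1 / 3 : ℝ)) := by
  open Opportunistic in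
  -- The learning rate can be constant because the path length does not grow with the epoch; `1/128`
  -- is the largest rate `stability_bound` admits.
  refine ⟨500, epochCount, fun _ _ _ _ => 1 / 128, by norm_num,
    fun T dP D ε hT => ⟨one_le_epochCount T dP D ε, epochCount_le hT dP D ε⟩,
    fun _ _ _ _ => by norm_num, ?_⟩
  intro dP dL d D hdP hD hdLD P 𝓛 hPc hP hP1 hPn _ h𝓛 u hu pstar hpstar ε hε hε' T hT
  refine ⟨exists_isActionCover hdP hT hPn, fun N hN lam₀ hlam => ?_⟩
  have hPne : P.Nonempty := ⟨0, hP1 (by simp)⟩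
  have hL1 := one_le_epochCount T dP D ε
  have hLT := epochCount_le hT dP D ε
  have hT' : (1 : ℝ) ≤ T := by exact_mod_cast hT
  have hT0 : (0 : ℝ) < T := by linarith
  have hdP' : (1 : ℝ) ≤ dP := by exact_mod_cast hdP
  have hD' : (1 : ℝ) ≤ D := by exact_mod_cast hD
  have hdLD' : (dL : ℝ) ≤ D := by exact_mod_cast hdLD
  refine ⟨fun ℓ _ t _ => epochLearner_mem hP hPne hL1 hLT _ hN _ lam₀ t,
    fun ℓ ℓ' t _ h => epochLearner_congr P pstar T _ ε _ N _ lam₀ h,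
    fun ℓ _ => ((qInt_range_nonempty hε hε' hT).image _).convexHull, fun ℓ hℓ => ?_⟩
  set a := ((dP : ℝ) / T) ^ (1 / 3 : ℝ) with ha
  set b := (ε * D) ^ (1 / 3 : ℝ) with hb
  have ha0 : 0 < a := Real.rpow_pos_of_pos (by positivity) _
  have hb0 : 0 ≤ b := Real.rpow_nonneg (by positivity) _
  have ha3 : a ^ 3 = dP / T := rpow_third_pow_three (by positivity)
  have hb3 : b ^ 3 = ε * D := rpow_third_pow_three (by positivity)
  have hlog : 0 ≤ Real.log T := Real.log_nonneg hT'
  -- If `a + b ≥ 1/4`, the claimed bound exceeds `2`, the trivial distance between points of the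
  -- unit ball. Otherwise `dP ≤ T`, neither clamp in `epochCount` is active, and epochs are long
  -- enough for Helly.
  rcases le_or_gt (1 / 4) (a + b) with hab | hab
  · obtain ⟨x, hx⟩ := qInt_range_nonempty (ℓ := ℓ) hε hε' hT
    have hx𝓛 := qInt_subset hε h𝓛 (fun t ht => hℓ t (Finset.mem_range.1 ht)) hx
    have h1 := infDist_le_two (norm_average_le hT fun t ht =>
        hu _ (epochLearner_mem (u := u) (pstar := pstar) (ε := ε) (ℓ := ℓ) hP hPne hL1 hLT
          (ε * D * T) hN (fun _ _ => 1 / 128) lam₀ t) (ℓ t) (hℓ t ht))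
      (subset_convexHull ℝ ((fun x => u (pstar x) x) '' qInt ε (Finset.range T) ℓ) ⟨x, hx, rfl⟩)
      (hu _ (hpstar x hx𝓛) x hx𝓛)
    refine h1.trans ?_
    have h2 : 0 ≤ a * Real.log T := mul_nonneg ha0.le hlog
    linarith
  · set r := 1 / (a + b) ^ 2 with hr
    have hρ : 0 < a + b := by linarith
    have hr1 : 1 ≤ r := by
      rw [hr, le_div_iff₀ (by positivity)]
      nlinarith
    have ha1 : a ^ 3 ≤ 1 := pow_le_one₀ ha0.le (by linarith)
    have hdPT : dP ≤ T := by
      rw [ha3, div_le_one hT0] at ha1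
      exact_mod_cast ha1
    have hTa : 1 / (T : ℝ) ≤ a ^ 3 := by
      rw [ha3]
      exact div_le_div_of_nonneg_right hdP' hT0.le
    have hρ3 : (a + b) ^ 3 ≤ (a + b) ^ 2 / 4 := by nlinarith [sq_nonneg (a + b)]
    have hab3 : a ^ 3 + b ^ 3 ≤ (a + b) ^ 3 := by
      have : 0 ≤ 3 * a * b * (a + b) := by positivity
      nlinarith
    have hrT : r ≤ T := by
      rw [hr, div_le_iff₀ (by positivity)]
      rw [div_le_iff₀ hT0] at hTa
      nlinarith [pow_nonneg hb0 3]
    have hcount : epochCount T dP D ε = ⌊r⌋₊ := by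
      rw [epochCount, ← ha, ← hb, ← hr, min_eq_right (Nat.floor_le_of_le hrT),
        max_eq_right (Nat.le_floor (by simpa using hr1))]
    have hLr : (epochCount T dP D ε : ℝ) ≤ r := hcount ▸ Nat.floor_le (by linarith)
    have hLr' : r - 1 < (epochCount T dP D ε : ℝ) := hcount ▸ Nat.sub_one_lt_floor r
    have hL1' : (1 : ℝ) ≤ (epochCount T dP D ε : ℝ) := by exact_mod_cast hL1
    have hlen : ((dL : ℝ) + 1) * (ε * T) < T / (epochCount T dP D ε : ℝ) - 1 := by
      have h1 : (a + b) ^ 2 ≤ 1 / (epochCount T dP D ε : ℝ) := by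
        rw [le_div_iff₀ (by linarith), mul_comm]
        rwa [hr, le_div_iff₀ (by positivity)] at hLr
      have h2 : ((dL : ℝ) + 1) * ε ≤ 2 * b ^ 3 := by
        rw [hb3]
        nlinarith
      -- Since `dL + 1 ≤ 2D` and `1/T ≤ a³`, the left side is at most `2(a+b)³ ≤ (a+b)²/2`, strictly
      -- below `(a+b)² ≤ 1/L`.
      have h3 : ((dL : ℝ) + 1) * ε + 1 / T < 1 / (epochCount T dP D ε : ℝ) := by
        nlinarith [pow_pos hρ 2, pow_pos ha0 3]
      have h4 := mul_lt_mul_of_pos_right h3 hT0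
      rw [add_mul, one_div_mul_cancel hT0.ne', one_div_mul_eq_div] at h4
      linarith
    have hmain := infDist_epochLearner_le hPc hP hP1 h𝓛 hu hpstar hε hdLD hL1 hLT hlen hℓ hN hlam
    refine hmain.trans ?_
    rw [← hb3]
    exact tuned_bound ha0 hb0 hT0 hdP' ha3 hL1' hLr hLr' hab.le hlog
      (log_card_cover_le (Finset.card_pos.2 (hN.nonempty hPne)) hdP hdPT hN.2.2)
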